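/- Let $G=(V,E)$ be a finite simple graph with $n\ge 3$ vertices, and let every vertex $v$ have an integer cap $\ell_{\max}(v)$. Consider the following synchronous randomized algorithm in the full-duplex beeping model. The state of a vertex $v$ is a level $\ell(v)\in\{-\ell_{\max}(v),\dots,\ell_{\max}(v)\}$. In every round, independently of the other vertices and of the past, $v$ beeps with probability $\min\{2^{-\ell(v)},1\}$ if $\ell(v)<\ell_{\max}(v)$, and it does not beep if $\ell(v)=\ell_{\max}(v)$. Then all vertices update their levels simultaneously: if at least one neighbor of $v$ has beeped, then $\ell(v)\leftarrow\min\{\ell(v)+1,\ell_{\max}(v)\}$; otherwise, if $v$ itself has beeped, then $\ell(v)\leftarrow-\ell_{\max}(v)$; otherwise $\ell(v)\leftarrow\max\{\ell(v)-1,1\}$. A vertex $v$ is in the set $I$ if $\ell(v)=-\ell_{\max}(v)$ and $\ell(u)=\ell_{\max}(u)$ for every neighbor $u$ of $v$; the vertices of $I$ and their neighbors are called stable. The algorithm has stabilized to an MIS if all vertices are stable, $I$ is a maximal independent set of $G$, and $I$ remains the same in all later rounds, whatever the random choices are. Theorem. For all real constants $c_1\ge 30$, $c_2>0$ and $a>0$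 there is a constant $C>0$, depending only on $c_1,c_2,a$, such that the following holds for every $n\ge 3$ and every $n$-vertex graph $G$. If $$2\log_2\deg(v)+c_1\;\le\;\ell_{\max}(v)\;\le\; c_2\log_2 n\qquad\text{for every vertex } v$$ (where $\log_2 0$ is read as $0$, so that the cap of an isolated vertex is at least $c_1$), then, from any initial configuration of levels and for every integer $T\ge C\log_2 n\cdot\log_2\log_2 n$, the algorithm has stabilized to an MIS after $T$ rounds with probability at least $1-n^{-a}$. That is, it stabilizes to an MIS from any configuration within $O(\log n\cdot\log\log n)$ rounds with high probability. -/

import Mathlib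

open scoped NNReal ENNReal

namespace BeepingMIS

noncomputable section

/-- A configuration: the current level `ℓ(v)` of every vertex `v`. -/
abbrev Config (V : Type*) := V → ℤ

/-- The configurations of the algorithm: the level of `v` lies in `{-ℓmax(v), …, ℓmax(v)}`. -/
def IsConfig {V : Type*} (lmax : V → ℕ) (c : Config V) : Prop :=
  ∀ v, -(lmax v : ℤ) ≤ c v ∧ c v ≤ (lmax v : ℤ)

/-- The probability that a vertex with cap `m` and level `l` beeps:
`min {2^(-l), 1}` if `l < m`, and `0` otherwise. -/
def beepProb (m : ℕ) (l : ℤ) : ℝ≥0 :=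
  if l < (m : ℤ) then min ((2 : ℝ≥0) ^ (-l)) 1 else 0

theorem beepProb_le_one (m : ℕ) (l : ℤ) : beepProb m l ≤ 1 := by
  unfold beepProb
  split_ifs
  · exact min_le_right _ _
  · exact zero_le_one

/-- The law of the beeps of one round (`b v = true` iff `v` beeps) from the configuration `c`:
the vertices decide independently, and `v` beeps with probability `beepProb (lmax v) (c v)`. -/
def beepLaw {V : Type*} [Fintype V] (lmax : V → ℕ) (c : Config V) : PMF (V → Bool) := by
  classical
  exact PMF.ofFintype
    (fun b => ∏ v, ((if b v = true then beepProb (lmax v) (c v)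
      else 1 - beepProb (lmax v) (c v) : ℝ≥0) : ℝ≥0∞))
    (by
      rw [← Fintype.prod_sum fun v x => ((if x = true then beepProb (lmax v) (c v)
        else 1 - beepProb (lmax v) (c v) : ℝ≥0) : ℝ≥0∞)]
      refine Finset.prod_eq_one fun v _ => ?_
      rw [Fintype.sum_bool]
      simp only [if_true, Bool.false_eq_true, if_false]
      rw [← ENNReal.coe_add, add_tsub_cancel_of_le (beepProb_le_one _ _), ENNReal.coe_one])

open Classical in
/-- The update of the levels at the end of a round in which exactly the vertices `v` with
`b v = true` have beeped. A vertex receives a signal iff one of its neighbors beeps. -/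
def update {V : Type*} (G : SimpleGraph V) (lmax : V → ℕ) (c : Config V) (b : V → Bool) :
    Config V := fun v =>
  if ∃ u, G.Adj v u ∧ b u = true then min (c v + 1) (lmax v : ℤ)
  else if b v = true then -(lmax v : ℤ)
  else max (c v - 1) 1

/-- One round of the algorithm: the law of the next configuration. -/
def round {V : Type*} [Fintype V] (G : SimpleGraph V) (lmax : V → ℕ) (c : Config V) :
    PMF (Config V) :=
  (beepLaw lmax c).map (update G lmax c)

/-- The law of the configuration after `t` rounds of the algorithm, started from `c`
(each round uses fresh randomness). -/
def law {V : Type*} [Fintype V] (G : SimpleGraph V) (lmax : V → ℕ) (c : Config V) :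
    ℕ → PMF (Config V)
  | 0 => PMF.pure c
  | t + 1 => (law G lmax c t).bind (round G lmax)

/-- The set `I` of the vertices that have joined the MIS: the level of `v` is `-ℓmax(v)`, and the
level of every neighbor `u` of `v` is `ℓmax(u)`. -/
def misSet {V : Type*} (G : SimpleGraph V) (lmax : V → ℕ) (c : Config V) : Set V :=
  {v | c v = -(lmax v : ℤ) ∧ ∀ u, G.Adj v u → c u = (lmax u : ℤ)}

/-- The set `S = I ∪ N(I)` of the stable vertices. -/
def stableSet {V : Type*} (G : SimpleGraph V) (lmax : V → ℕ) (c : Config V) : Set V :=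
  misSet G lmax c ∪ {w | ∃ v ∈ misSet G lmax c, G.Adj v w}

/-- The algorithm has stabilized to an MIS in the configuration `c`: all vertices are stable, the
vertices that have joined the MIS form a maximal independent set of `G`, and this set never changes
again, whatever the random choices in later rounds are. -/
def StabilizedToMIS {V : Type*} [Fintype V] (G : SimpleGraph V) (lmax : V → ℕ)
    (c : Config V) : Prop :=
  stableSet G lmax c = Set.univ ∧
  Maximal G.IsIndepSet (misSet G lmax c) ∧
  ∀ t : ℕ, ∀ c' ∈ (law G lmax c t).support, misSet G lmax c' = misSet G lmax c

end

end BeepingMIS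

/-! A vertex at a level at most 0 beeps surely. After more rounds than the largest cap no two such
vertices are adjacent. From then on a vertex `u` at such a level makes all its neighbors rise and at
least halves their beeping probabilities in every round, while its own level rises by at most 1.
Hence `4 * nbrRate * (3/2)^level`, its `weight`, bounds the chance that `u` is overtaken before it
joins, and this weight drops by the factor 3/4 per round.

For a vertex `v` two quantities are followed: `attempt`, the least such weight in the closed
neighborhood of `v` (at most 1), and `spread`, which grows with the level of `v` and the weight
around it. By `attempt_or_spread_drift`, in each round either `attempt` loses a constant factor in
expectation while `spread` grows at most by the factor 4, or `spread` loses a constant factor while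
`attempt` does not grow. By Hölder, `spread^e * attempt^(1-e)` with small `e` contracts in both
cases. It is at most polynomial in `n`, and at least inverse polynomial as long as `v` is not
`Settled`, so Markov's inequality settles `v` within `O(log n)` rounds with high probability.

The drift has an additive error: unsettled neighbors that drop back from their caps contribute the
sum of their `2^(-lmax u)`. As `2^(lmax u) ≥ 2^30 * deg(u)^2`, this is negligible for `deg v < 2
s^2` once all vertices of degree below `s` are settled (`sum_capRate_le`). So the vertices are
settled in phases with degree thresholds 2, 4, 16, 256, ..., squared each time. There are `log log n
+ O(1)` phases of `O(log n)` rounds each, and a union bound finishes the proof. -/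

set_option linter.unusedSectionVars false

namespace BeepingMIS

/-! ### Independent Bernoulli variables: silence, lonely beeps, Hölder's inequality. -/

section Bernoulli

variable {V : Type*} [Fintype V] [DecidableEq V]

/-- The weight of `b` under independent Bernoulli variables with success probabilities `p`. -/
def bernWeight (p : V → ℝ) (b : V → Bool) : ℝ := ∏ v, if b v = true then p v else 1 - p v

/-- The expectation of `f` under independent Bernoulli variables with success probabilities `p`. -/
def bernExp (p : V → ℝ) (f : (V → Bool) → ℝ) : ℝ := ∑ b, bernWeight p b * f b

variable {p : V → ℝ}

theorem bernWeight_nonneg (h0 : ∀ v, 0 ≤ p v) (h1 : ∀ v, p v ≤ 1) (b : V → Bool) :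
    0 ≤ bernWeight p b :=
  Finset.prod_nonneg fun v _ => by
    split_ifs
    · exact h0 v
    · linarith [h1 v]

theorem bernExp_mono (h0 : ∀ v, 0 ≤ p v) (h1 : ∀ v, p v ≤ 1) {f g : (V → Bool) → ℝ}
    (h : ∀ b, bernWeight p b ≠ 0 → f b ≤ g b) : bernExp p f ≤ bernExp p g := by
  refine Finset.sum_le_sum fun b _ => ?_
  by_cases hb : bernWeight p b = 0
  · simp [hb]
  · exact mul_le_mul_of_nonneg_left (h b hb) (bernWeight_nonneg h0 h1 b)

theorem bernExp_add (f g : (V → Bool) → ℝ) :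
    bernExp p (fun b => f b + g b) = bernExp p f + bernExp p g := by
  simp [bernExp, mul_add, Finset.sum_add_distrib]

theorem bernExp_const_mul (k : ℝ) (f : (V → Bool) → ℝ) :
    bernExp p (fun b => k * f b) = k * bernExp p f := by
  simp only [bernExp, Finset.mul_sum]
  exact Finset.sum_congr rfl fun b _ => by ring

theorem bernExp_sum {ι : Type*} (s : Finset ι) (f : ι → (V → Bool) → ℝ) :
    bernExp p (fun b => ∑ i ∈ s, f i b) = ∑ i ∈ s, bernExp p (f i) := by
  simp only [bernExp, Finset.mul_sum]
  exact Finset.sum_comm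

theorem bernExp_prod (h : V → Bool → ℝ) :
    bernExp p (fun b => ∏ v, h v (b v)) = ∏ v, (p v * h v true + (1 - p v) * h v false) := by
  simp only [bernExp, bernWeight, ← Finset.prod_mul_distrib]
  rw [← Fintype.prod_sum fun v x => (if x = true then p v else 1 - p v) * h v x]
  simp

theorem bernExp_const (k : ℝ) : bernExp p (fun _ => k) = k := by
  have h := bernExp_prod (p := p) fun _ _ => 1
  have h2 := bernExp_const_mul (p := p) k fun _ => 1
  simp only [Finset.prod_const_one, mul_one] at h h2
  rw [h2, h]
  simp

theorem bernExp_nonneg (h0 : ∀ v, 0 ≤ p v) (h1 : ∀ v, p v ≤ 1) {f : (V → Bool) → ℝ}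
    (h : ∀ b, 0 ≤ f b) : 0 ≤ bernExp p f :=
  Finset.sum_nonneg fun b _ => mul_nonneg (bernWeight_nonneg h0 h1 b) (h b)

theorem bernExp_silent (F : Finset V) :
    bernExp p (fun b => if ∀ x ∈ F, b x = false then 1 else 0) = ∏ x ∈ F, (1 - p x) := by
  have h := bernExp_prod (p := p) fun v x => if v ∈ F ∧ x = true then 0 else 1
  have h3 : ∀ b : V → Bool, (∏ v, if v ∈ F ∧ b v = true then (0 : ℝ) else 1)
      = if ∀ x ∈ F, b x = false then 1 else 0 := by
    intro b
    split_ifs with hb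
    · exact Finset.prod_eq_one fun v _ => if_neg fun hv => by simp [hb v hv.1] at hv
    · push Not at hb
      obtain ⟨x, hx, hbx⟩ := hb
      exact Finset.prod_eq_zero (Finset.mem_univ x) (if_pos ⟨hx, by simpa using hbx⟩)
  simp only [h3] at h
  rw [h, ← Finset.prod_subset (Finset.subset_univ F)]
  · exact Finset.prod_congr rfl fun x hx => by simp [hx]
  · intro x _ hx
    simp [hx]

theorem bernExp_beep_silent {u : V} {F : Finset V} (hu : u ∉ F) :
    bernExp p (fun b => if b u = true ∧ ∀ x ∈ F, b x = false then 1 else 0)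
      = p u * ∏ x ∈ F, (1 - p x) := by
  have h1 := bernExp_silent (p := p) F
  have h2 := bernExp_silent (p := p) (insert u F)
  rw [Finset.prod_insert hu] at h2
  have h3 : bernExp p (fun b => if ∀ x ∈ F, b x = false then 1 else 0)
      = bernExp p (fun b => if b u = true ∧ ∀ x ∈ F, b x = false then 1 else 0)
      + bernExp p (fun b => if ∀ x ∈ insert u F, b x = false then 1 else 0) := by
    rw [← bernExp_add]
    congr 1
    funext b
    by_cases hb : b u = true <;> by_cases hF : ∀ x ∈ F, b x = false <;> simp_all
  rw [h1, h2] at h3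
  linarith

theorem bernExp_beep (u : V) : bernExp p (fun b => if b u = true then 1 else 0) = p u := by
  have h := bernExp_beep_silent (p := p) (u := u) (F := ∅) (by simp)
  simpa using h

theorem bernExp_exists_beep_le (h0 : ∀ v, 0 ≤ p v) (h1 : ∀ v, p v ≤ 1) (F : Finset V) :
    bernExp p (fun b => if ∃ x ∈ F, b x = true then 1 else 0) ≤ ∑ x ∈ F, p x := by
  calc _ ≤ bernExp p (fun b => ∑ x ∈ F, if b x = true then 1 else 0) := by
        refine bernExp_mono h0 h1 fun b _ => ?_
        split_ifs with hb
        · obtain ⟨x, hx, hbx⟩ := hb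
          refine le_trans (by simp [hbx]) (Finset.single_le_sum
            (f := fun x => if b x = true then (1 : ℝ) else 0) (fun i _ => ?_) hx)
          split_ifs <;> norm_num
        · exact Finset.sum_nonneg fun i _ => by split_ifs <;> norm_num
    _ = _ := by rw [bernExp_sum]; exact Finset.sum_congr rfl fun x _ => bernExp_beep x

theorem prod_one_sub_le_exp (h1 : ∀ v, p v ≤ 1) (F : Finset V) :
    ∏ x ∈ F, (1 - p x) ≤ Real.exp (-∑ x ∈ F, p x) := by
  rw [← Finset.sum_neg_distrib, Real.exp_sum]
  exact Finset.prod_le_prod (fun x _ => by linarith [h1 x]) fun x _ => Real.one_sub_le_exp_neg _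

theorem exp_le_prod_one_sub {F : Finset V} (h0 : ∀ x ∈ F, 0 ≤ p x) (h2 : ∀ x ∈ F, p x ≤ 1 / 2) :
    Real.exp (-(2 * ∑ x ∈ F, p x)) ≤ ∏ x ∈ F, (1 - p x) := by
  rw [Finset.mul_sum, ← Finset.sum_neg_distrib, Real.exp_sum]
  refine Finset.prod_le_prod (fun x _ => (Real.exp_pos _).le) fun x hx => ?_
  have a0 := h0 x hx
  have a2 := h2 x hx
  have h : 1 ≤ (1 - p x) * Real.exp (2 * p x) := by
    have := Real.add_one_le_exp (2 * p x)
    nlinarith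
  rw [Real.exp_neg]
  rw [inv_le_iff_one_le_mul₀ (Real.exp_pos _)]
  exact h

/-- A lower bound on the probability that some vertex of `S` succeeds while all vertices of its
neighborhood `N u` fail. -/
theorem le_bernExp_exists_lonely (h0 : ∀ v, 0 ≤ p v) (h1 : ∀ v, p v ≤ 1) {N : V → Finset V}
    (hN : ∀ u, u ∉ N u) {k : ℝ} (S : Finset V) (hk : ∀ u ∈ S, k ≤ ∏ x ∈ N u, (1 - p x)) :
    k * (1 - ∏ x ∈ S, (1 - p x)) ≤
      bernExp p (fun b => if ∃ u ∈ S, b u = true ∧ ∀ x ∈ N u, b x = false then 1 else 0) := by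
  have q0 : ∀ v, 0 ≤ 1 - p v := fun v => by linarith [h1 v]
  have q1 : ∀ v, 1 - p v ≤ 1 := fun v => by linarith [h0 v]
  induction S using Finset.induction_on with
  | empty => simp [bernExp_const]
  | insert u S hu ih =>
    have ih := ih fun x hx => hk x (Finset.mem_insert_of_mem hx)
    have hku := hk u (Finset.mem_insert_self u S)
    have hnot : u ∉ S ∪ N u := by simp [hu, hN u]
    -- No independence of the two silences is needed: common factors are at most 1 and occur only
    -- once in the union.
    have hprod : (∏ x ∈ S, (1 - p x)) * (∏ x ∈ N u, (1 - p x)) ≤ ∏ x ∈ S ∪ N u, (1 - p x) := by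
      rw [← Finset.prod_union_inter]
      refine mul_le_of_le_one_right (Finset.prod_nonneg fun x _ => q0 x) ?_
      exact Finset.prod_le_one (fun x _ => q0 x) fun x _ => q1 x
    -- The new event, `u` beeping while all of `S ∪ N u` is silent, is disjoint from the event for
    -- `S`, so the probabilities add up and telescope to `1 - ∏`.
    have hstep : bernExp p (fun b => if ∃ u ∈ S, b u = true ∧ ∀ x ∈ N u, b x = false then 1 else 0)
        + bernExp p (fun b => if b u = true ∧ ∀ x ∈ S ∪ N u, b x = false then 1 else 0)
        ≤ bernExp p (fun b =>
          if ∃ w ∈ insert u S, b w = true ∧ ∀ x ∈ N w, b x = false then 1 else 0) := by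
      rw [← bernExp_add]
      refine bernExp_mono h0 h1 fun b _ => ?_
      by_cases hA : ∃ u ∈ S, b u = true ∧ ∀ x ∈ N u, b x = false
      · obtain ⟨w, hw, hbw, hs⟩ := hA
        have hB : ¬ (b u = true ∧ ∀ x ∈ S ∪ N u, b x = false) := fun h => by
          simp [h.2 w (Finset.mem_union_left _ hw)] at hbw
        rw [if_neg hB, if_pos ⟨w, hw, hbw, hs⟩,
          if_pos ⟨w, Finset.mem_insert_of_mem hw, hbw, hs⟩]
        norm_num
      · rw [if_neg hA]
        by_cases hB : b u = true ∧ ∀ x ∈ S ∪ N u, b x = false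
        · rw [if_pos hB, if_pos ⟨u, Finset.mem_insert_self u S, hB.1, fun x hx =>
            hB.2 x (Finset.mem_union_right _ hx)⟩]
          norm_num
        · rw [if_neg hB]
          split_ifs <;> norm_num
    rw [bernExp_beep_silent hnot] at hstep
    rw [Finset.prod_insert hu]
    have hS : 0 ≤ ∏ x ∈ S, (1 - p x) := Finset.prod_nonneg fun x _ => q0 x
    have h5 : p u * ((∏ x ∈ S, (1 - p x)) * k) ≤ p u * ∏ x ∈ S ∪ N u, (1 - p x) :=
      mul_le_mul_of_nonneg_left ((mul_le_mul_of_nonneg_left hku hS).trans hprod) (h0 u)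
    linarith

/-- Hölder's inequality for a weighted geometric mean. -/
theorem bernExp_rpow_mul_rpow_le (h0 : ∀ v, 0 ≤ p v) (h1 : ∀ v, p v ≤ 1) {X Y : (V → Bool) → ℝ}
    (hX : ∀ b, 0 ≤ X b) (hY : ∀ b, 0 ≤ Y b) {x y e : ℝ} (he0 : 0 < e) (he1 : e < 1)
    (hx : 0 < x) (hEX : bernExp p X ≤ x) (hEY : bernExp p Y ≤ y) :
    bernExp p (fun b => X b ^ e * Y b ^ (1 - e)) ≤ x ^ e * y ^ (1 - e) := by
  have hy : 0 ≤ y := (bernExp_nonneg h0 h1 hY).trans hEY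
  rcases hy.eq_or_lt with rfl | hy
  · have hz : ∀ b, bernWeight p b * Y b = 0 := fun b =>
      (Finset.sum_eq_zero_iff_of_nonneg fun b _ =>
        mul_nonneg (bernWeight_nonneg h0 h1 b) (hY b)).1
        (le_antisymm hEY (bernExp_nonneg h0 h1 hY)) b (Finset.mem_univ b)
    rw [Real.zero_rpow (by linarith), mul_zero]
    refine (Finset.sum_eq_zero fun b _ => ?_).le
    rcases mul_eq_zero.1 (hz b) with h | h
    · simp [h]
    · simp [h, Real.zero_rpow (by linarith : 1 - e ≠ 0)]
  · have hxy : 0 < x ^ e * y ^ (1 - e) := by positivity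
    -- Weighted AM-GM for the normalized values `X / x` and `Y / y`, averaged over `b`. The case `y
    -- = 0` had to be treated apart.
    have key : bernExp p (fun b => (x ^ e * y ^ (1 - e))⁻¹ * (X b ^ e * Y b ^ (1 - e))) ≤
        bernExp p (fun b => e / x * X b + (1 - e) / y * Y b) := by
      refine bernExp_mono h0 h1 fun b _ => ?_
      have h := Real.geom_mean_le_arith_mean2_weighted he0.le (by linarith : 0 ≤ 1 - e)
        (div_nonneg (hX b) hx.le) (div_nonneg (hY b) hy.le) (by ring)
      rw [Real.div_rpow (hX b) hx.le, Real.div_rpow (hY b) hy.le] at h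
      calc _ = X b ^ e / x ^ e * (Y b ^ (1 - e) / y ^ (1 - e)) := by field_simp
        _ ≤ _ := h
        _ = _ := by ring
    rw [bernExp_const_mul, bernExp_add, bernExp_const_mul, bernExp_const_mul] at key
    have k1 : e / x * bernExp p X ≤ e := by
      calc _ ≤ e / x * x := mul_le_mul_of_nonneg_left hEX (by positivity)
        _ = e := by field_simp
    have k2 : (1 - e) / y * bernExp p Y ≤ 1 - e := by
      calc _ ≤ (1 - e) / y * y :=
            mul_le_mul_of_nonneg_left hEY (div_nonneg (by linarith) hy.le)
        _ = 1 - e := by field_simp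
    have k3 := key.trans (add_le_add k1 k2)
    rw [inv_mul_le_iff₀ hxy] at k3
    linarith

end Bernoulli

/-! ### Beeping probabilities under one step up or down. -/

section Rate

/-- The beeping probability as a real number. -/
noncomputable def rate (m : ℕ) (l : ℤ) : ℝ := (beepProb m l : ℝ)

theorem rate_nonneg (m : ℕ) (l : ℤ) : 0 ≤ rate m l := NNReal.coe_nonneg _

theorem rate_le_one (m : ℕ) (l : ℤ) : rate m l ≤ 1 := by
  have := beepProb_le_one m l
  exact_mod_cast this

theorem rate_of_le {m : ℕ} {l : ℤ} (h : (m : ℤ) ≤ l) : rate m l = 0 := by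
  simp [rate, beepProb, not_lt.2 h]

theorem rate_of_nonpos {m : ℕ} {l : ℤ} (hm : 0 < m) (h : l ≤ 0) : rate m l = 1 := by
  have h1 : l < (m : ℤ) := by omega
  have h2 : (1 : ℝ) ≤ 2 ^ (-l) := one_le_zpow₀ (by norm_num) (by omega)
  simp only [rate, beepProb, if_pos h1]
  push_cast
  exact min_eq_right h2

theorem rate_of_pos {m : ℕ} {l : ℤ} (h0 : 0 ≤ l) (h : l < m) : rate m l = 2 ^ (-l) := by
  have h2 : (2 : ℝ) ^ (-l) ≤ 1 := zpow_le_one_of_nonpos₀ (by norm_num) (by omega)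
  simp only [rate, beepProb, if_pos h]
  push_cast
  exact min_eq_left h2

theorem rate_le_half {m : ℕ} {l : ℤ} (h : 1 ≤ l) : rate m l ≤ 1 / 2 := by
  rcases le_or_gt (m : ℤ) l with h1 | h1
  · rw [rate_of_le h1]; norm_num
  · rw [rate_of_pos (by omega) h1]
    calc (2 : ℝ) ^ (-l) ≤ 2 ^ (-1 : ℤ) := zpow_le_zpow_right₀ (by norm_num) (by omega)
      _ = 1 / 2 := by norm_num

theorem rate_up_le {m : ℕ} {l : ℤ} (h : 1 ≤ l) : rate m (min (l + 1) m) ≤ rate m l / 2 := by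
  rcases le_or_gt (m : ℤ) (l + 1) with h1 | h1
  · rw [min_eq_right h1, rate_of_le le_rfl]
    have := rate_nonneg m l
    linarith
  · rw [min_eq_left h1.le, rate_of_pos (by omega) h1, rate_of_pos (by omega) (by omega)]
    rw [neg_add, zpow_add₀ (by norm_num)]
    norm_num
    linarith

theorem rate_down_le {m : ℕ} {l : ℤ} (h : 1 ≤ l) (hm : l < m) :
    rate m (max (l - 1) 1) ≤ 2 * rate m l := by
  rcases le_or_gt l 1 with h1 | h1
  · have : l = 1 := by omega
    subst this
    have := rate_nonneg m 1
    norm_num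
    linarith
  · rw [max_eq_left (by omega), rate_of_pos (by omega) (by omega), rate_of_pos (by omega) hm]
    rw [neg_sub, sub_eq_add_neg, zpow_add₀ (by norm_num)]
    norm_num

/-- At the cap the rate is 0, so no multiplicative bound like `rate_down_le` can hold. This is the
source of the additive error in the drift. -/
theorem rate_down_cap {m : ℕ} (hm : 2 ≤ m) :
    rate m (max ((m : ℤ) - 1) 1) = 2 * 2 ^ (-(m : ℤ)) := by
  rw [max_eq_left (by omega), rate_of_pos (by omega) (by omega), neg_sub, sub_eq_add_neg,
    zpow_add₀ (by norm_num)]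
  norm_num

theorem le_rate_of_lt {m L : ℕ} {l : ℤ} (h : l < m) (hL : m ≤ L) (hm : 0 < m) :
    ((2 : ℝ) ^ L)⁻¹ ≤ rate m l := by
  rcases le_or_gt l 0 with h1 | h1
  · rw [rate_of_nonpos hm h1]
    exact inv_le_one_of_one_le₀ (one_le_pow₀ (by norm_num))
  · rw [rate_of_pos h1.le h, ← zpow_natCast, ← zpow_neg]
    exact zpow_le_zpow_right₀ (by norm_num) (by omega)

end Rate

/-! ### Effect of one round on levels and weights, for fixed beeps. -/

section Dynamics

variable {V : Type*} [Fintype V] [DecidableEq V] (G : SimpleGraph V) [DecidableRel G.Adj]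
  (lmax : V → ℕ)

/-- The vector of beeping probabilities of a configuration. -/
noncomputable def rates (c : Config V) (v : V) : ℝ := rate (lmax v) (c v)

/-- The sum of the beeping probabilities of the neighbors of `u`. -/
noncomputable def nbrRate (c : Config V) (u : V) : ℝ := ∑ x ∈ G.neighborFinset u, rates lmax c x

/-- Some neighbor of `v` beeps. -/
def Hears (b : V → Bool) (v : V) : Prop := ∃ u, G.Adj v u ∧ b u = true

/-- The beeps `b` are possible in the configuration `c`. -/
def Legal (c : Config V) (b : V → Bool) : Prop :=
  ∀ v, (c v ≤ 0 → b v = true) ∧ ((lmax v : ℤ) ≤ c v → b v = false)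

/-- No two adjacent vertices have nonpositive levels. -/
def NoProminentPair (c : Config V) : Prop := ∀ u x, G.Adj u x → c u ≤ 0 → 1 ≤ c x

/-- The caps are at least `30` and at least `2 log₂ deg + 30`. -/
def LargeCaps : Prop := ∀ v, 30 ≤ lmax v ∧ (G.degree v : ℝ) ^ 2 * 2 ^ 30 ≤ 2 ^ lmax v

/-- The weight of a neighbor: its beeping probability, or, if it beeps surely, a bound on
the probability that it will fail to join. -/
noncomputable def weight (c : Config V) (u : V) : ℝ :=
  if c u ≤ 0 then 4 * nbrRate G lmax c u * (3 / 2 : ℝ) ^ c u else rates lmax c u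

variable {G lmax} {c : Config V} {b : V → Bool}

theorem rates_nonneg (v : V) : 0 ≤ rates lmax c v := rate_nonneg _ _

theorem rates_le_one (v : V) : rates lmax c v ≤ 1 := rate_le_one _ _

theorem nbrRate_nonneg (u : V) : 0 ≤ nbrRate G lmax c u :=
  Finset.sum_nonneg fun _ _ => rates_nonneg _

theorem weight_nonneg (u : V) : 0 ≤ weight G lmax c u := by
  unfold weight
  split_ifs
  · have := nbrRate_nonneg (G := G) (lmax := lmax) (c := c) u
    positivity
  · exact rates_nonneg u

theorem legal_of_bernWeight_ne_zero (hm : ∀ v, 0 < lmax v)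
    (h : bernWeight (rates lmax c) b ≠ 0) : Legal lmax c b := by
  rw [bernWeight, Finset.prod_ne_zero_iff] at h
  refine fun v => ⟨fun hv => ?_, fun hv => ?_⟩ <;> have h := h v (Finset.mem_univ v) <;>
    by_contra hb
  · rw [if_neg hb, rates, rate_of_nonpos (hm v) hv] at h
    simp at h
  · rw [if_pos (by simpa using hb), rates, rate_of_le hv] at h
    exact h rfl

theorem update_of_hears {v : V} (h : Hears G b v) :
    update G lmax c b v = min (c v + 1) (lmax v : ℤ) := if_pos h

theorem update_of_lonely {v : V} (h : ¬ Hears G b v) (hv : b v = true) :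
    update G lmax c b v = -(lmax v : ℤ) := by
  unfold update
  exact (if_neg h).trans (if_pos hv)

theorem update_of_silent {v : V} (h : ¬ Hears G b v) (hv : ¬ b v = true) :
    update G lmax c b v = max (c v - 1) 1 := by
  unfold update
  exact (if_neg h).trans (if_neg hv)

theorem one_le_of_not_hears (hb : Legal lmax c b) {u x : V} (h : ¬ Hears G b u)
    (hx : G.Adj u x) : 1 ≤ c x := by
  by_contra hlt
  exact h ⟨x, hx, (hb x).1 (by omega)⟩

theorem isConfig_update (hm : ∀ v, 0 < lmax v) (hc : IsConfig lmax c) :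
    IsConfig lmax (update G lmax c b) := by
  intro v
  have h1 := hc v
  have h2 := hm v
  by_cases h : Hears G b v
  · rw [update_of_hears h]; omega
  · by_cases hv : b v = true
    · rw [update_of_lonely h hv]; omega
    · rw [update_of_silent h hv]; omega

/-- A vertex falls to a negative level only by beeping without hearing. Its neighbors were then
positive and hear it, so they stay positive. A vertex that is nonpositive before the round beeps
surely and so keeps its neighbors positive too. -/
theorem noProminentPair_update (hm : ∀ v, 1 < lmax v) (hI : NoProminentPair G c)
    (hb : Legal lmax c b) : NoProminentPair G (update G lmax c b) := by
  intro u x hux hu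
  have mu := hm u
  have mx := hm x
  by_cases h : Hears G b u
  · rw [update_of_hears h] at hu
    have hu1 : c u ≤ 0 := by omega
    have hx1 := hI u x hux hu1
    have : Hears G b x := ⟨u, hux.symm, (hb u).1 hu1⟩
    rw [update_of_hears this]
    omega
  · by_cases hbu : b u = true
    · have hx1 := one_le_of_not_hears hb h hux
      rw [update_of_hears ⟨u, hux.symm, hbu⟩]
      omega
    · rw [update_of_silent h hbu] at hu
      omega

theorem rates_update_le_half {x : V} (h : Hears G b x) (hx : 1 ≤ c x) :
    rates lmax (update G lmax c b) x ≤ rates lmax c x / 2 := by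
  rw [rates, update_of_hears h]
  exact rate_up_le hx

theorem nbrRate_update_le_half {u : V} (hu : b u = true) (h : ∀ x, G.Adj u x → 1 ≤ c x) :
    nbrRate G lmax (update G lmax c b) u ≤ nbrRate G lmax c u / 2 := by
  rw [nbrRate, nbrRate, Finset.sum_div]
  refine Finset.sum_le_sum fun x hx => ?_
  rw [SimpleGraph.mem_neighborFinset] at hx
  exact rates_update_le_half ⟨u, hx.symm, hu⟩ (h x hx)

theorem LargeCaps.pos (hL : LargeCaps G lmax) (v : V) : 0 < lmax v := by
  have := (hL v).1
  omega

theorem LargeCaps.one_lt (hL : LargeCaps G lmax) (v : V) : 1 < lmax v := by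
  have := (hL v).1
  omega

/-- Since `(3/2)^2 ≥ 2`, the coefficient 2 of the logarithm in the caps is what lets `(3/2)^lmax`
dominate the degree. -/
theorem LargeCaps.degree_le (hL : LargeCaps G lmax) (v : V) :
    (G.degree v : ℝ) * 2 ^ 15 ≤ (3 / 2) ^ lmax v := by
  have h1 : ((G.degree v : ℝ) * 2 ^ 15) ^ 2 ≤ ((3 / 2 : ℝ) ^ lmax v) ^ 2 := by
    calc ((G.degree v : ℝ) * 2 ^ 15) ^ 2 = (G.degree v : ℝ) ^ 2 * 2 ^ 30 := by ring
      _ ≤ 2 ^ lmax v := (hL v).2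
      _ ≤ (9 / 4) ^ lmax v := pow_le_pow_left₀ (by norm_num) (by norm_num) _
      _ = _ := by rw [← pow_mul, mul_comm, pow_mul]; norm_num
  exact le_of_sq_le_sq h1 (by positivity)

/-- All neighbors have positive levels, hence rates at most 1/2, which the beep halves. The weight
becomes at most `deg * (3/2)^(-lmax) ≤ 2^(-15)`. -/
theorem weight_update_of_lonely (hL : LargeCaps G lmax) (hb : Legal lmax c b) {u : V}
    (h : ¬ Hears G b u) (hu : b u = true) :
    update G lmax c b u ≤ 0 ∧ weight G lmax (update G lmax c b) u ≤ 1 / 1000 := by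
  have h0 : update G lmax c b u = -(lmax u : ℤ) := update_of_lonely h hu
  have h1 : update G lmax c b u ≤ 0 := by omega
  refine ⟨h1, ?_⟩
  have hn : ∀ x, G.Adj u x → 1 ≤ c x := fun x hx => one_le_of_not_hears hb h hx
  have hd := nbrRate_update_le_half (lmax := lmax) hu hn
  have hd2 : nbrRate G lmax c u ≤ G.degree u * (1 / 2) := by
    rw [← SimpleGraph.card_neighborFinset_eq_degree, ← nsmul_eq_mul]
    refine Finset.sum_le_card_nsmul _ _ _ fun x hx => ?_
    rw [SimpleGraph.mem_neighborFinset] at hx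
    exact rate_le_half (hn x hx)
  rw [weight, if_pos h1, h0, zpow_neg, zpow_natCast, ← div_eq_mul_inv,
    div_le_iff₀ (by positivity)]
  have := hL.degree_le u
  linarith

/-- The rising level costs the factor 3/2, the halved rates of the neighbors gain 1/2. -/
theorem weight_update_of_neg (hI : NoProminentPair G c) (hb : Legal lmax c b) {u : V}
    (h : Hears G b u) (hu : c u < 0) :
    update G lmax c b u ≤ 0 ∧ weight G lmax (update G lmax c b) u ≤ 3 / 4 * weight G lmax c u := by
  have h0 : update G lmax c b u = c u + 1 := by rw [update_of_hears h]; omega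
  have h1 : update G lmax c b u ≤ 0 := by omega
  refine ⟨h1, ?_⟩
  have hd := nbrRate_update_le_half (lmax := lmax) ((hb u).1 hu.le) fun x hx => hI u x hx hu.le
  rw [weight, weight, if_pos h1, if_pos hu.le, h0, zpow_add₀ (by norm_num), zpow_one]
  have hz : (0 : ℝ) < (3 / 2) ^ c u := by positivity
  nlinarith

theorem weight_update_of_zero (hL : LargeCaps G lmax) {u : V} (h : Hears G b u) (hu : c u = 0) :
    weight G lmax (update G lmax c b) u = 1 / 2 := by
  have hm := hL.one_lt u
  have h0 : update G lmax c b u = 1 := by rw [update_of_hears h]; omega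
  rw [weight, if_neg (by omega), rates, h0, rate_of_pos (by omega) (by omega)]
  norm_num

theorem weight_update_of_not_hears (hc : IsConfig lmax c) (hb : Legal lmax c b) {u : V}
    (h : ¬ Hears G b u) (hu : c u ≤ 0) :
    update G lmax c b u ≤ 0 ∧ weight G lmax (update G lmax c b) u ≤ 1 / 2 * weight G lmax c u := by
  have hbu := (hb u).1 hu
  have h0 : update G lmax c b u = -(lmax u : ℤ) := update_of_lonely h hbu
  have h1 : update G lmax c b u ≤ 0 := by omega
  refine ⟨h1, ?_⟩
  have hd := nbrRate_update_le_half (lmax := lmax) hbu fun x hx => one_le_of_not_hears hb h hx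
  have hz : (3 / 2 : ℝ) ^ (-(lmax u : ℤ)) ≤ (3 / 2) ^ c u :=
    zpow_le_zpow_right₀ (by norm_num) (hc u).1
  have hn := nbrRate_nonneg (G := G) (lmax := lmax) (c := c) u
  rw [weight, weight, if_pos h1, if_pos hu, h0]
  calc _ ≤ 4 * (nbrRate G lmax c u / 2) * (3 / 2 : ℝ) ^ c u := by gcongr
    _ = _ := by ring

theorem weight_update_of_hears_pos {u : V} (h : Hears G b u) (hu : 1 ≤ c u)
    (hL : LargeCaps G lmax) :
    weight G lmax (update G lmax c b) u ≤ rates lmax c u / 2 := by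
  have hm := hL.one_lt u
  have h0 := update_of_hears (lmax := lmax) (c := c) h
  rw [weight, if_neg (by rw [h0]; omega)]
  exact rates_update_le_half h hu

theorem weight_update_of_silent_pos {u : V} (h : ¬ Hears G b u) (hbu : ¬ b u = true)
    (hu : 1 ≤ c u) (hm : c u < lmax u) :
    weight G lmax (update G lmax c b) u ≤ 2 * rates lmax c u := by
  have h0 := update_of_silent (lmax := lmax) (c := c) h hbu
  rw [weight, if_neg (by rw [h0]; omega), rates, h0]
  exact rate_down_le hu hm

theorem weight_update_of_cap (hL : LargeCaps G lmax) (hb : Legal lmax c b) {u : V}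
    (h : ¬ Hears G b u) (hm : c u = lmax u) :
    weight G lmax (update G lmax c b) u = 2 * 2 ^ (-(lmax u : ℤ)) := by
  have hbu : ¬ b u = true := by simp [(hb u).2 hm.ge]
  have h0 := update_of_silent (lmax := lmax) (c := c) h hbu
  have := hL.one_lt u
  rw [weight, if_neg (by rw [h0]; omega), rates, h0, hm]
  exact rate_down_cap (by omega)

end Dynamics

/-! ### Expected change of weight, attempt and spread in one round. -/

section Drift

variable {V : Type*} [Fintype V] [DecidableEq V] (G : SimpleGraph V) [DecidableRel G.Adj]
  (lmax : V → ℕ)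

/-- `v` or one of its neighbors beeps surely, and all neighbors of that vertex are at their caps. -/
def Settled (c : Config V) (v : V) : Prop :=
  ∃ u ∈ insert v (G.neighborFinset v), c u ≤ 0 ∧ ∀ x, G.Adj u x → (lmax x : ℤ) ≤ c x

/-- A bound on the probability that no vertex of the closed neighborhood of `v` that currently
beeps surely will join. -/
noncomputable def attempt (c : Config V) (v : V) : ℝ :=
  (insert v (G.neighborFinset v)).inf' (Finset.insert_nonempty _ _)
    fun u => if c u ≤ 0 then min 1 (weight G lmax c u) else 1

/-- The total weight of the neighbors of `v`. -/
noncomputable def nbrWeight (c : Config V) (v : V) : ℝ :=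
  ∑ u ∈ G.neighborFinset v, weight G lmax c u

/-- The part of the potential that measures the level of `v` and the weight of its neighbors. -/
noncomputable def spread (c : Config V) (v : V) : ℝ :=
  (6 / 5 : ℝ) ^ max (c v) 1 * (nbrWeight G lmax c v + 1 / 100)

open Classical in
/-- The least positive beeping probability, up to a factor, of a vertex that is not settled. -/
noncomputable def capRate (c : Config V) (u : V) : ℝ :=
  if Settled G lmax c u then 0 else 2 ^ (-(lmax u : ℤ))

/-- A vertex that has a constant probability to be the only one to beep in its neighborhood once
it beeps. -/
def Light (c : Config V) (u : V) : Prop :=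
  1 ≤ c u ∧ (∀ x, G.Adj u x → 1 ≤ c x) ∧ nbrRate G lmax c u ≤ 3

open Classical in
/-- The light neighbors of `v`. -/
noncomputable def lightNbrs (c : Config V) (v : V) : Finset V :=
  {u ∈ G.neighborFinset v | Light G lmax c u}

variable {G lmax} {c : Config V} {b : V → Bool}

theorem mem_lightNbrs {u v : V} :
    u ∈ lightNbrs G lmax c v ↔ u ∈ G.neighborFinset v ∧ Light G lmax c u := by
  simp [lightNbrs]

theorem hears_iff {u : V} : Hears G b u ↔ ∃ x ∈ G.neighborFinset u, b x = true := by
  simp [Hears]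

theorem not_hears_iff {u : V} : ¬ Hears G b u ↔ ∀ x ∈ G.neighborFinset u, b x = false := by
  simp [Hears]

theorem capRate_nonneg (u : V) : 0 ≤ capRate G lmax c u := by
  unfold capRate
  split_ifs <;> positivity

theorem bernExp_rates_mono (hL : LargeCaps G lmax) {f g : (V → Bool) → ℝ}
    (h : ∀ b, Legal lmax c b → f b ≤ g b) :
    bernExp (rates lmax c) f ≤ bernExp (rates lmax c) g :=
  bernExp_mono rates_nonneg rates_le_one fun b hb =>
    h b (legal_of_bernWeight_ne_zero hL.pos hb)

theorem bernExp_hears_le (u : V) :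
    bernExp (rates lmax c) (fun b => if ∃ x ∈ G.neighborFinset u, b x = true then 1 else 0)
      ≤ nbrRate G lmax c u :=
  bernExp_exists_beep_le rates_nonneg rates_le_one _

theorem weight_of_zero {u : V} (hu : c u = 0) : weight G lmax c u = 4 * nbrRate G lmax c u := by
  simp [weight, hu]

/-- Only level 0 is random: `u` hears with probability at most `nbrRate = w/4` and then has weight
1/2 at level 1, so the mean is at most `w/2 + w/8`. -/
theorem bernExp_weight_of_nonpos (hL : LargeCaps G lmax) (hc : IsConfig lmax c)
    (hI : NoProminentPair G c) {u : V} (hu : c u ≤ 0) :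
    bernExp (rates lmax c) (fun b => weight G lmax (update G lmax c b) u)
      ≤ 3 / 4 * weight G lmax c u := by
  have hw := weight_nonneg (G := G) (lmax := lmax) (c := c) u
  rcases hu.lt_or_eq with h | h
  · rw [← bernExp_const (p := rates lmax c) (3 / 4 * weight G lmax c u)]
    refine bernExp_rates_mono hL fun b hb => ?_
    by_cases hh : Hears G b u
    · exact (weight_update_of_neg hI hb hh h).2
    · have := (weight_update_of_not_hears hc hb hh hu).2
      linarith
  · have hz := weight_of_zero (G := G) (lmax := lmax) h
    calc _ ≤ bernExp (rates lmax c) (fun b => 1 / 2 * weight G lmax c u +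
          1 / 2 * (if ∃ x ∈ G.neighborFinset u, b x = true then 1 else 0)) := by
          refine bernExp_rates_mono hL fun b hb => ?_
          by_cases hh : Hears G b u
          · rw [weight_update_of_zero hL hh h, if_pos (hears_iff.1 hh)]
            linarith
          · have := (weight_update_of_not_hears hc hb hh hu).2
            rw [if_neg (fun h => hh (hears_iff.2 h))]
            linarith
      _ ≤ _ := by
          rw [bernExp_add, bernExp_const, bernExp_const_mul]
          have := bernExp_hears_le (G := G) (lmax := lmax) (c := c) u
          linarith

/-- The reason why `capRate` vanishes at settled vertices: one at its cap has a neighbor that beeps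
surely, so it does not leave the cap. -/
theorem hears_of_settled_of_cap (hL : LargeCaps G lmax) (hb : Legal lmax c b) {u : V}
    (hs : Settled G lmax c u) (hu : c u = lmax u) : Hears G b u := by
  obtain ⟨x, hx, hx0, -⟩ := hs
  have hm := hL.pos u
  rcases Finset.mem_insert.1 hx with rfl | hx
  · omega
  · exact ⟨x, by simpa using hx, (hb x).1 hx0⟩

/-- Hearing halves the weight, silence around `u` at most doubles it, a lonely beep leaves at most
1/1000, and an unsettled vertex at its cap leaks `2 * capRate`. -/
theorem bernExp_weight_of_pos (hL : LargeCaps G lmax) (hc : IsConfig lmax c) {u : V}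
    (hu : 1 ≤ c u) :
    bernExp (rates lmax c) (fun b => weight G lmax (update G lmax c b) u)
      ≤ (501 / 1000 + 2 * ∏ x ∈ G.neighborFinset u, (1 - rates lmax c x)) * weight G lmax c u
        + 2 * capRate G lmax c u := by
  have hw : weight G lmax c u = rates lmax c u := if_neg (by omega)
  have hr := rates_nonneg (lmax := lmax) (c := c) u
  have he := capRate_nonneg (G := G) (lmax := lmax) (c := c) u
  calc _ ≤ bernExp (rates lmax c) (fun b => 1 / 2 * rates lmax c u +
        (2 * rates lmax c u * (if ∀ x ∈ G.neighborFinset u, b x = false then 1 else 0) +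
        (1 / 1000 * (if b u = true then 1 else 0) + 2 * capRate G lmax c u))) := by
        refine bernExp_rates_mono hL fun b hb => ?_
        by_cases hh : Hears G b u
        · have := weight_update_of_hears_pos hh hu hL
          have h1 : (0 : ℝ) ≤ if b u = true then 1 else 0 := by split_ifs <;> norm_num
          have h2 : (0 : ℝ) ≤ if ∀ x ∈ G.neighborFinset u, b x = false then 1 else 0 := by
            split_ifs <;> norm_num
          have h3 := mul_nonneg (mul_nonneg (zero_le_two (α := ℝ)) hr) h2
          linarith
        · rw [if_pos (not_hears_iff.1 hh)]
          by_cases hbu : b u = true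
          · have := (weight_update_of_lonely hL hb hh hbu).2
            rw [if_pos hbu]
            linarith
          · rw [if_neg hbu]
            rcases (hc u).2.lt_or_eq with hm | hm
            · have := weight_update_of_silent_pos (lmax := lmax) hh hbu hu hm
              linarith
            · rw [weight_update_of_cap hL hb hh hm, capRate,
                if_neg fun hs => hh (hears_of_settled_of_cap hL hb hs hm)]
              linarith
    _ = _ := by
        rw [bernExp_add, bernExp_add, bernExp_add, bernExp_const, bernExp_const_mul,
          bernExp_const_mul, bernExp_const, bernExp_beep, bernExp_silent, hw]
        ring

theorem bernExp_weight_le (hL : LargeCaps G lmax) (hc : IsConfig lmax c)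
    (hI : NoProminentPair G c) (u : V) :
    bernExp (rates lmax c) (fun b => weight G lmax (update G lmax c b) u)
      ≤ 13 / 5 * weight G lmax c u + 2 * capRate G lmax c u := by
  have hw := weight_nonneg (G := G) (lmax := lmax) (c := c) u
  have he := capRate_nonneg (G := G) (lmax := lmax) (c := c) u
  rcases le_or_gt (c u) 0 with hu | hu
  · have := bernExp_weight_of_nonpos hL hc hI hu
    linarith
  · have h := bernExp_weight_of_pos hL hc hu
    have hP : ∏ x ∈ G.neighborFinset u, (1 - rates lmax c x) ≤ 1 :=
      Finset.prod_le_one (fun x _ => sub_nonneg.2 (rates_le_one x)) fun x _ =>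
        sub_le_self _ (rates_nonneg x)
    nlinarith

theorem exp_neg_three_le : Real.exp (-3) ≤ 1 / 10 := by
  have h := Real.exp_one_gt_d9
  have h3 : Real.exp 3 = Real.exp 1 ^ 3 := by rw [← Real.exp_nat_mul]; norm_num
  have h4 : (27 / 10 : ℝ) ^ 3 ≤ Real.exp 1 ^ 3 := pow_le_pow_left₀ (by norm_num) (by linarith) 3
  rw [Real.exp_neg, inv_le_comm₀ (Real.exp_pos _) (by norm_num), h3]
  norm_num at h4 ⊢
  linarith

theorem le_exp_neg_six : 1 / 1000 ≤ Real.exp (-6) := by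
  have h := Real.exp_one_lt_d9
  have h3 : Real.exp 6 = Real.exp 1 ^ 6 := by rw [← Real.exp_nat_mul]; norm_num
  have h4 : Real.exp 1 ^ 6 ≤ (2.72 : ℝ) ^ 6 :=
    pow_le_pow_left₀ (Real.exp_pos _).le (by linarith) 6
  rw [Real.exp_neg, le_inv_comm₀ (by norm_num) (Real.exp_pos _), h3]
  norm_num at h4 ⊢
  linarith

/-- A positive vertex that is not light has a neighbor that beeps surely, or `nbrRate > 3`. So it
hears nothing with probability at most `exp (-3) ≤ 1/10`, and `501/1000 + 2/10 ≤ 3/4`. -/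
theorem bernExp_weight_le_of_not_light (hL : LargeCaps G lmax) (hc : IsConfig lmax c)
    (hI : NoProminentPair G c) {u : V} (hu : ¬ Light G lmax c u) :
    bernExp (rates lmax c) (fun b => weight G lmax (update G lmax c b) u)
      ≤ 3 / 4 * weight G lmax c u + 2 * capRate G lmax c u := by
  have hw := weight_nonneg (G := G) (lmax := lmax) (c := c) u
  have he := capRate_nonneg (G := G) (lmax := lmax) (c := c) u
  rcases le_or_gt (c u) 0 with h0 | h0
  · have := bernExp_weight_of_nonpos hL hc hI h0
    linarith
  · have h := bernExp_weight_of_pos hL hc h0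
    have hP : ∏ x ∈ G.neighborFinset u, (1 - rates lmax c x) ≤ 1 / 10 := by
      by_cases hn : ∀ x, G.Adj u x → 1 ≤ c x
      · have hd : 3 < nbrRate G lmax c u := by
          by_contra hd
          exact hu ⟨h0, hn, not_lt.1 hd⟩
        refine (prod_one_sub_le_exp rates_le_one _).trans (le_trans ?_ exp_neg_three_le)
        exact Real.exp_le_exp.2 (neg_le_neg hd.le)
      · push Not at hn
        obtain ⟨x, hx, hx0⟩ := hn
        rw [Finset.prod_eq_zero (i := x) (by simpa using hx)]
        · norm_num
        · rw [rates, rate_of_nonpos (hL.pos x) (by omega), sub_self]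
    nlinarith

theorem nbrWeight_nonneg (v : V) : 0 ≤ nbrWeight G lmax c v :=
  Finset.sum_nonneg fun _ _ => weight_nonneg _

theorem bernExp_nbrWeight_le (hL : LargeCaps G lmax) (hc : IsConfig lmax c)
    (hI : NoProminentPair G c) (v : V) :
    bernExp (rates lmax c) (fun b => nbrWeight G lmax (update G lmax c b) v)
      ≤ 13 / 5 * nbrWeight G lmax c v + 2 * ∑ u ∈ G.neighborFinset v, capRate G lmax c u := by
  simp only [nbrWeight]
  rw [bernExp_sum, Finset.mul_sum, Finset.mul_sum, ← Finset.sum_add_distrib]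
  exact Finset.sum_le_sum fun u _ => bernExp_weight_le hL hc hI u

theorem bernExp_nbrWeight_le_of_light (hL : LargeCaps G lmax) (hc : IsConfig lmax c)
    (hI : NoProminentPair G c) (v : V) :
    bernExp (rates lmax c) (fun b => nbrWeight G lmax (update G lmax c b) v)
      ≤ 3 / 4 * nbrWeight G lmax c v + 2 * ∑ u ∈ G.neighborFinset v, capRate G lmax c u
        + 13 / 5 * ∑ u ∈ lightNbrs G lmax c v, rates lmax c u := by
  simp only [nbrWeight, lightNbrs]
  rw [Finset.sum_filter, bernExp_sum, Finset.mul_sum, Finset.mul_sum, Finset.mul_sum,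
    ← Finset.sum_add_distrib, ← Finset.sum_add_distrib]
  refine Finset.sum_le_sum fun u _ => ?_
  split_ifs with h
  · have h1 := bernExp_weight_le hL hc hI u
    have h2 : weight G lmax c u = rates lmax c u := if_neg (by have := h.1; omega)
    have h3 := rates_nonneg (lmax := lmax) (c := c) u
    linarith
  · have h1 := bernExp_weight_le_of_not_light hL hc hI h
    linarith

theorem attempt_le_one (v : V) : attempt G lmax c v ≤ 1 := by
  refine (Finset.inf'_le _ (Finset.mem_insert_self v _)).trans ?_
  split_ifs
  · exact min_le_left _ _
  · exact le_rfl

theorem attempt_nonneg (v : V) : 0 ≤ attempt G lmax c v := by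
  refine Finset.le_inf' _ _ fun u _ => ?_
  split_ifs
  · exact le_min zero_le_one (weight_nonneg u)
  · exact zero_le_one

theorem attempt_le_weight {u v : V} (hu : u ∈ insert v (G.neighborFinset v)) (h : c u ≤ 0) :
    attempt G lmax c v ≤ weight G lmax c u := by
  refine (Finset.inf'_le _ hu).trans ?_
  rw [if_pos h]
  exact min_le_right _ _

theorem exists_attempt_eq_weight {v : V} (h : attempt G lmax c v < 1) :
    ∃ u ∈ insert v (G.neighborFinset v), c u ≤ 0 ∧ attempt G lmax c v = weight G lmax c u := by
  obtain ⟨u, hu, he⟩ := Finset.exists_mem_eq_inf' (Finset.insert_nonempty v (G.neighborFinset v))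
    fun u => if c u ≤ 0 then min 1 (weight G lmax c u) else 1
  change attempt G lmax c v = _ at he
  rw [he] at h ⊢
  split_ifs at h ⊢ with h0
  · refine ⟨u, hu, h0, min_eq_right (le_of_lt ?_)⟩
    by_contra hw
    rw [min_eq_left (not_lt.1 hw)] at h
    exact lt_irrefl _ h
  · exact absurd h (lt_irrefl _)

/-- Here the factor 4 in `weight` is used up: at level 0 a failure resets `attempt` to at most 1,
with probability at most `w/4`, and `w/2 + w/4 = 3/4 * w`. -/
theorem bernExp_attempt_le_weight (hL : LargeCaps G lmax) (hc : IsConfig lmax c)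
    (hI : NoProminentPair G c) {u v : V} (hu : u ∈ insert v (G.neighborFinset v)) (h : c u ≤ 0) :
    bernExp (rates lmax c) (fun b => attempt G lmax (update G lmax c b) v)
      ≤ 3 / 4 * weight G lmax c u := by
  have hw := weight_nonneg (G := G) (lmax := lmax) (c := c) u
  rcases h.lt_or_eq with h0 | h0
  · rw [← bernExp_const (p := rates lmax c) (3 / 4 * weight G lmax c u)]
    refine bernExp_rates_mono hL fun b hb => ?_
    by_cases hh : Hears G b u
    · obtain ⟨h1, h2⟩ := weight_update_of_neg (lmax := lmax) hI hb hh h0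
      exact (attempt_le_weight hu h1).trans h2
    · obtain ⟨h1, h2⟩ := weight_update_of_not_hears hc hb hh h
      have := attempt_le_weight (lmax := lmax) hu h1
      linarith
  · have hz := weight_of_zero (G := G) (lmax := lmax) h0
    calc _ ≤ bernExp (rates lmax c) (fun b => 1 / 2 * weight G lmax c u +
          (if ∃ x ∈ G.neighborFinset u, b x = true then 1 else 0)) := by
          refine bernExp_rates_mono hL fun b hb => ?_
          by_cases hh : Hears G b u
          · have := attempt_le_one (G := G) (lmax := lmax) (c := update G lmax c b) v
            rw [if_pos (hears_iff.1 hh)]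
            linarith
          · obtain ⟨h1, h2⟩ := weight_update_of_not_hears hc hb hh h
            have := attempt_le_weight (lmax := lmax) hu h1
            rw [if_neg (fun h => hh (hears_iff.2 h))]
            linarith
      _ ≤ _ := by
          rw [bernExp_add, bernExp_const]
          have := bernExp_hears_le (G := G) (lmax := lmax) (c := c) u
          linarith

theorem bernExp_attempt_le_of_lonely (hL : LargeCaps G lmax) {v : V} {S : Finset V}
    (hS : S ⊆ insert v (G.neighborFinset v)) {k : ℝ}
    (hk : ∀ u ∈ S, k ≤ ∏ x ∈ G.neighborFinset u, (1 - rates lmax c x)) :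
    bernExp (rates lmax c) (fun b => attempt G lmax (update G lmax c b) v)
      ≤ 1 - 999 / 1000 * (k * (1 - ∏ u ∈ S, (1 - rates lmax c u))) := by
  have h := le_bernExp_exists_lonely (p := rates lmax c) rates_nonneg rates_le_one
    (N := fun u => G.neighborFinset u) (fun u => by simp) S hk
  calc _ ≤ bernExp (rates lmax c) (fun b => 1 + -(999 / 1000) *
        (if ∃ u ∈ S, b u = true ∧ ∀ x ∈ G.neighborFinset u, b x = false then 1 else 0)) := by
        refine bernExp_rates_mono hL fun b hb => ?_
        split_ifs with hu
        · obtain ⟨u, hu, hbu, hn⟩ := hu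
          obtain ⟨h1, h2⟩ := weight_update_of_lonely hL hb (not_hears_iff.2 hn) hbu
          have := attempt_le_weight (lmax := lmax) (hS hu) h1
          linarith
        · have := attempt_le_one (G := G) (lmax := lmax) (c := update G lmax c b) v
          linarith
    _ ≤ _ := by
        rw [bernExp_add, bernExp_const, bernExp_const_mul]
        linarith

theorem level_update_le (v : V) : max (update G lmax c b v) 1 ≤ max (c v) 1 + 1 := by
  by_cases h : Hears G b v
  · rw [update_of_hears h]; omega
  · by_cases hv : b v = true
    · rw [update_of_lonely h hv]; omega
    · rw [update_of_silent h hv]; omega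

theorem spread_pos (v : V) : 0 < spread G lmax c v := by
  have := nbrWeight_nonneg (G := G) (lmax := lmax) (c := c) v
  unfold spread
  positivity

theorem bernExp_spread_le (hL : LargeCaps G lmax) (v : V) :
    bernExp (rates lmax c) (fun b => spread G lmax (update G lmax c b) v)
      ≤ (6 / 5 : ℝ) ^ max (c v) 1 * (6 / 5 *
        (bernExp (rates lmax c) (fun b => nbrWeight G lmax (update G lmax c b) v) + 1 / 100)) := by
  rw [← bernExp_const (p := rates lmax c) (1 / 100), ← bernExp_add, ← bernExp_const_mul,
    ← bernExp_const_mul]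
  refine bernExp_rates_mono hL fun b _ => ?_
  have hw := nbrWeight_nonneg (G := G) (lmax := lmax) (c := update G lmax c b) v
  have hz : (6 / 5 : ℝ) ^ max (update G lmax c b v) 1 ≤ (6 / 5) ^ max (c v) 1 * (6 / 5) := by
    rw [← zpow_add_one₀ (by norm_num)]
    exact zpow_le_zpow_right₀ (by norm_num) (level_update_le v)
  rw [spread, ← mul_assoc]
  exact mul_le_mul_of_nonneg_right hz (by linarith)

/-- From level 2 on, the level part falls by 5/6 unless `v` hears. Thus the summand 1/100 becomes
1/120, or 6/500 if `v` hears, and the difference is 11/3000. -/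
theorem bernExp_spread_le_of_two_le (hL : LargeCaps G lmax) {v : V} (hv : 2 ≤ c v) :
    bernExp (rates lmax c) (fun b => spread G lmax (update G lmax c b) v)
      ≤ (6 / 5 : ℝ) ^ max (c v) 1 *
        (6 / 5 * bernExp (rates lmax c) (fun b => nbrWeight G lmax (update G lmax c b) v)
          + (1 / 120 + 11 / 3000 * nbrRate G lmax c v)) := by
  have hz0 : (0 : ℝ) < (6 / 5 : ℝ) ^ max (c v) 1 := by positivity
  calc _ ≤ bernExp (rates lmax c) (fun b => (6 / 5 : ℝ) ^ max (c v) 1 *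
        (6 / 5 * nbrWeight G lmax (update G lmax c b) v + (1 / 120 + 11 / 3000 *
          (if ∃ x ∈ G.neighborFinset v, b x = true then 1 else 0)))) := by
        refine bernExp_rates_mono hL fun b _ => ?_
        have hw := nbrWeight_nonneg (G := G) (lmax := lmax) (c := update G lmax c b) v
        by_cases hh : Hears G b v
        · have hz : (6 / 5 : ℝ) ^ max (update G lmax c b v) 1 ≤ (6 / 5) ^ max (c v) 1 * (6 / 5) := by
            rw [← zpow_add_one₀ (by norm_num)]
            exact zpow_le_zpow_right₀ (by norm_num) (level_update_le v)
          rw [if_pos (hears_iff.1 hh), spread]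
          calc _ ≤ (6 / 5 : ℝ) ^ max (c v) 1 * (6 / 5) *
                (nbrWeight G lmax (update G lmax c b) v + 1 / 100) :=
                mul_le_mul_of_nonneg_right hz (by linarith)
            _ = _ := by ring
        · have hz : (6 / 5 : ℝ) ^ max (update G lmax c b v) 1 ≤ (6 / 5) ^ max (c v) 1 * (5 / 6) := by
            have h1 : (6 / 5 : ℝ) ^ max (c v) 1 * (5 / 6) = (6 / 5) ^ (max (c v) 1 - 1) := by
              rw [zpow_sub_one₀ (by norm_num)]; norm_num
            rw [h1]
            refine zpow_le_zpow_right₀ (by norm_num) ?_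
            by_cases hbv : b v = true
            · rw [update_of_lonely hh hbv]; omega
            · rw [update_of_silent hh hbv]; omega
          rw [if_neg fun h => hh (hears_iff.2 h), spread]
          calc _ ≤ (6 / 5 : ℝ) ^ max (c v) 1 * (5 / 6) *
                (nbrWeight G lmax (update G lmax c b) v + 1 / 100) :=
                mul_le_mul_of_nonneg_right hz (by linarith)
            _ ≤ _ := by rw [mul_assoc]; gcongr; linarith
    _ ≤ _ := by
        rw [bernExp_const_mul, bernExp_add, bernExp_add, bernExp_const, bernExp_const_mul,
          bernExp_const_mul]
        gcongr
        exact bernExp_hears_le v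

theorem prod_one_sub_rates_ge {u : V} (h : ∀ x, G.Adj u x → 1 ≤ c x) :
    Real.exp (-(2 * nbrRate G lmax c u)) ≤ ∏ x ∈ G.neighborFinset u, (1 - rates lmax c x) :=
  exp_le_prod_one_sub (fun x _ => rates_nonneg x) fun x hx => rate_le_half (h x (by simpa using hx))

/-- In every round either a constant fraction of the chance to fail vanishes in expectation, or
the spread shrinks by a constant factor in expectation. -/
theorem attempt_or_spread_drift (hL : LargeCaps G lmax) (hc : IsConfig lmax c)
    (hI : NoProminentPair G c) {v : V}
    (hv : ∑ u ∈ G.neighborFinset v, capRate G lmax c u ≤ 1 / 100000) :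
    (bernExp (rates lmax c) (fun b => spread G lmax (update G lmax c b) v)
        ≤ 4 * spread G lmax c v ∧
      bernExp (rates lmax c) (fun b => attempt G lmax (update G lmax c b) v)
        ≤ (1 - 1 / 10 ^ 8) * attempt G lmax c v) ∨
    (bernExp (rates lmax c) (fun b => spread G lmax (update G lmax c b) v)
        ≤ 19 / 20 * spread G lmax c v ∧
      bernExp (rates lmax c) (fun b => attempt G lmax (update G lmax c b) v)
        ≤ 1 * attempt G lmax c v) := by
  have hz : (0 : ℝ) < (6 / 5 : ℝ) ^ max (c v) 1 := by positivity
  have hW := nbrWeight_nonneg (G := G) (lmax := lmax) (c := c) v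
  have hA0 := attempt_nonneg (G := G) (lmax := lmax) (c := c) v
  have hgrow : bernExp (rates lmax c) (fun b => spread G lmax (update G lmax c b) v)
      ≤ 4 * spread G lmax c v := by
    refine (bernExp_spread_le hL v).trans ?_
    have := bernExp_nbrWeight_le hL hc hI v
    rw [spread, mul_left_comm (4 : ℝ)]
    refine mul_le_mul_of_nonneg_left ?_ hz.le
    linarith
  -- If `attempt < 1`, it is the weight of a vertex that beeps surely, and contracts by 3/4.
  rcases (attempt_le_one (G := G) (lmax := lmax) (c := c) v).lt_or_eq with hA | hA
  · obtain ⟨u, hu, hu0, he⟩ := exists_attempt_eq_weight hA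
    refine Or.inl ⟨hgrow, ?_⟩
    have := bernExp_attempt_le_weight hL hc hI hu hu0
    rw [← he] at this
    linarith
  · rw [hA]
    have hA1 : bernExp (rates lmax c) (fun b => attempt G lmax (update G lmax c b) v) ≤ 1 * 1 := by
      rw [one_mul, ← bernExp_const (p := rates lmax c) 1]
      exact bernExp_rates_mono hL fun b _ => attempt_le_one v
    -- Light neighbors of noticeable total rate: with constant probability one of them beeps alone,
    -- which brings `attempt` down to 1/1000.
    rcases le_or_gt (1 / 10000) (∑ u ∈ lightNbrs G lmax c v, rates lmax c u) with hl | hl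
    · refine Or.inl ⟨hgrow, ?_⟩
      have hS : lightNbrs G lmax c v ⊆ insert v (G.neighborFinset v) :=
        fun u hu => Finset.mem_insert_of_mem (mem_lightNbrs.1 hu).1
      have h1 := bernExp_attempt_le_of_lonely hL (c := c) hS (k := 1 / 1000) fun u hu => by
        have hu : Light G lmax c u := (mem_lightNbrs.1 hu).2
        refine le_exp_neg_six.trans (le_trans ?_ (prod_one_sub_rates_ge hu.2.1))
        exact Real.exp_le_exp.2 (by linarith [hu.2.2])
      have h2 : ∏ u ∈ lightNbrs G lmax c v, (1 - rates lmax c u) ≤ 10000 / 10001 := by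
        refine (prod_one_sub_le_exp rates_le_one _).trans ?_
        refine (Real.exp_le_exp.2 (neg_le_neg hl)).trans ?_
        have := Real.add_one_le_exp (1 / 10000 : ℝ)
        rw [Real.exp_neg, inv_le_comm₀ (Real.exp_pos _) (by norm_num)]
        norm_num at this ⊢
        linarith
      linarith
    · have hw := bernExp_nbrWeight_le_of_light hL hc hI v
      -- Light neighbors are now negligible, so the neighbor weight contracts by 3/4 up to small
      -- errors. If it is at least 1/10 it absorbs these errors and the growth 6/5 of the level
      -- part.
      rcases le_or_gt (1 / 10) (nbrWeight G lmax c v) with hb | hb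
      · refine Or.inr ⟨?_, hA1⟩
        refine (bernExp_spread_le hL v).trans ?_
        rw [spread, mul_left_comm (19 / 20 : ℝ)]
        refine mul_le_mul_of_nonneg_left ?_ hz.le
        linarith
      -- As `attempt = 1`, nonpositive vertices near `v` weigh at least 1. A total below 1/10 rules
      -- them out among the neighbors, and then also at `v`.
      · have hp : ∀ u ∈ insert v (G.neighborFinset v), c u ≤ 0 → 1 ≤ weight G lmax c u :=
          fun u hu h0 => hA ▸ attempt_le_weight hu h0
        have hn : ∀ u, G.Adj v u → 1 ≤ c u := by
          intro u hu
          by_contra h0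
          have h1 := hp u (Finset.mem_insert_of_mem (by simpa using hu)) (by omega)
          have h2 : weight G lmax c u ≤ nbrWeight G lmax c v :=
            Finset.single_le_sum (fun x _ => weight_nonneg x) (by simpa using hu)
          linarith
        have hd : nbrRate G lmax c v = nbrWeight G lmax c v := by
          refine Finset.sum_congr rfl fun u hu => ?_
          have := hn u (by simpa using hu)
          rw [weight, if_neg (by omega)]
        rcases le_or_gt 2 (c v) with h2 | h2
        · refine Or.inr ⟨?_, hA1⟩
          refine (bernExp_spread_le_of_two_le hL h2).trans ?_
          rw [spread, mul_left_comm (19 / 20 : ℝ)]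
          refine mul_le_mul_of_nonneg_left ?_ hz.le
          linarith
        · have hv1 : c v = 1 := by
            by_contra hv1
            have h0 : c v ≤ 0 := by omega
            have h1 := hp v (Finset.mem_insert_self _ _) h0
            have h3 : (3 / 2 : ℝ) ^ c v ≤ 1 := zpow_le_one_of_nonpos₀ (by norm_num) h0
            rw [weight, if_pos h0, hd] at h1
            nlinarith
          refine Or.inl ⟨hgrow, ?_⟩
          -- At level 1 the level part cannot fall, but `v` itself beeps with probability 1/2, and
          -- its neighbors are silent with probability at least `exp (-1/5) ≥ 4/5`.
          have h1 := bernExp_attempt_le_of_lonely hL (c := c) (v := v) (S := {v}) (by simp)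
            (k := 4 / 5) fun u hu => by
              rw [Finset.mem_singleton.1 hu]
              refine le_trans ?_ (prod_one_sub_rates_ge hn)
              have := Real.add_one_le_exp (-(2 * nbrRate G lmax c v))
              linarith
          have hm := hL.one_lt v
          rw [Finset.prod_singleton, rates, hv1, rate_of_pos (by omega) (by omega)] at h1
          norm_num at h1 ⊢
          linarith

end Drift

/-! ### The potential: contraction, two-sided bounds, and persistence of settled vertices. -/

section Potential

variable {V : Type*} [Fintype V] [DecidableEq V] (G : SimpleGraph V) [DecidableRel G.Adj]
  (lmax : V → ℕ)

/-- The potential of `v`: a weighted geometric mean of its spread and its attempt. -/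
noncomputable def potential (e : ℝ) (c : Config V) (v : V) : ℝ :=
  spread G lmax c v ^ e * attempt G lmax c v ^ (1 - e)

variable {G lmax} {c : Config V} {b : V → Bool}

/-- At `e = 0` the first product is below 1, hence by continuity for small `e`; the second is below
1 for every `e > 0`. -/
theorem exists_drift_constants : ∃ e k : ℝ, 0 < e ∧ e < 1 ∧ 0 < k ∧ k < 1 ∧
    (4 : ℝ) ^ e * (1 - 1 / 10 ^ 8) ^ (1 - e) ≤ k ∧ (19 / 20 : ℝ) ^ e * 1 ^ (1 - e) ≤ k := by
  have hc : Continuous fun e : ℝ => (4 : ℝ) ^ e * (1 - 1 / 10 ^ 8) ^ (1 - e) :=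
    (Real.continuous_const_rpow (by norm_num)).mul
      ((Real.continuous_const_rpow (by norm_num)).comp (continuous_const.sub continuous_id))
  have h1 : ∀ᶠ e in nhds (0 : ℝ), (4 : ℝ) ^ e * (1 - 1 / 10 ^ 8) ^ (1 - e) < 1 :=
    hc.continuousAt.eventually_lt continuousAt_const (by norm_num)
  obtain ⟨r, hr, h⟩ := Metric.eventually_nhds_iff.1 h1
  have h2 := lt_min hr one_pos
  have he0 : 0 < min r 1 / 2 := by linarith
  have he1 : min r 1 / 2 < 1 := by linarith [min_le_right r 1]
  have he := h (y := min r 1 / 2) (by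
    rw [Real.dist_eq, sub_zero, abs_of_pos he0]; linarith [min_le_left r 1])
  refine ⟨min r 1 / 2, _, he0, he1, ?_, ?_, le_max_left _ _, le_max_right _ _⟩
  · exact lt_max_of_lt_right (by positivity)
  · refine max_lt he ?_
    rw [Real.one_rpow, mul_one]
    exact Real.rpow_lt_one (by norm_num) (by norm_num) he0

theorem potential_nonneg (e : ℝ) (v : V) : 0 ≤ potential G lmax e c v :=
  mul_nonneg (Real.rpow_nonneg (spread_pos v).le _) (Real.rpow_nonneg (attempt_nonneg v) _)

theorem bernExp_potential_le (hL : LargeCaps G lmax) (hc : IsConfig lmax c)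
    (hI : NoProminentPair G c) {v : V}
    (hv : ∑ u ∈ G.neighborFinset v, capRate G lmax c u ≤ 1 / 100000) {e k : ℝ}
    (he0 : 0 < e) (he1 : e < 1) (h1 : (4 : ℝ) ^ e * (1 - 1 / 10 ^ 8) ^ (1 - e) ≤ k)
    (h2 : (19 / 20 : ℝ) ^ e * 1 ^ (1 - e) ≤ k) :
    bernExp (rates lmax c) (fun b => potential G lmax e (update G lmax c b) v)
      ≤ k * potential G lmax e c v := by
  have key : ∀ x y : ℝ, 0 < x → 0 ≤ y → x ^ e * y ^ (1 - e) ≤ k →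
      bernExp (rates lmax c) (fun b => spread G lmax (update G lmax c b) v)
        ≤ x * spread G lmax c v →
      bernExp (rates lmax c) (fun b => attempt G lmax (update G lmax c b) v)
        ≤ y * attempt G lmax c v →
      bernExp (rates lmax c) (fun b => potential G lmax e (update G lmax c b) v)
        ≤ k * potential G lmax e c v := by
    intro x y hx hy hk hs ha
    have hsp := spread_pos (G := G) (lmax := lmax) (c := c) v
    refine (bernExp_rpow_mul_rpow_le rates_nonneg rates_le_one (fun b => (spread_pos v).le)
      (fun b => attempt_nonneg v) he0 he1 (mul_pos hx hsp) hs ha).trans ?_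
    rw [Real.mul_rpow hx.le hsp.le, Real.mul_rpow hy (attempt_nonneg v), mul_mul_mul_comm]
    exact mul_le_mul_of_nonneg_right hk (potential_nonneg e v)
  rcases attempt_or_spread_drift hL hc hI hv with ⟨hs, ha⟩ | ⟨hs, ha⟩
  · exact key _ _ (by norm_num) (by norm_num) h1 hs ha
  · exact key _ _ (by norm_num) (by norm_num) h2 hs ha

/-- Every nonpositive vertex near an unsettled `v` has a neighbor below its cap, of rate at least
`2^(-L)`, and `(3/2)^level ≥ (3/2)^(-L)`. -/
theorem le_attempt_of_not_settled (hL : LargeCaps G lmax) (hc : IsConfig lmax c) {L : ℕ}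
    (hm : ∀ v, lmax v ≤ L) {v : V} (hv : ¬ Settled G lmax c v) :
    ((3 : ℝ) ^ L)⁻¹ ≤ attempt G lmax c v := by
  have h3 : ((3 : ℝ) ^ L)⁻¹ ≤ 1 := inv_le_one_of_one_le₀ (one_le_pow₀ (by norm_num))
  refine Finset.le_inf' _ _ fun u hu => ?_
  split_ifs with h0
  · refine le_min h3 ?_
    have hx : ∃ x, G.Adj u x ∧ c x < lmax x := by
      by_contra hx
      push Not at hx
      exact hv ⟨u, hu, h0, hx⟩
    obtain ⟨x, hux, hx⟩ := hx
    have hd : ((2 : ℝ) ^ L)⁻¹ ≤ nbrRate G lmax c u :=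
      (le_rate_of_lt hx (hm x) (hL.pos x)).trans
        (Finset.single_le_sum (f := rates lmax c) (fun y _ => rates_nonneg y) (by simpa using hux))
    have hz : ((3 / 2 : ℝ) ^ L)⁻¹ ≤ (3 / 2) ^ c u := by
      rw [← zpow_natCast, ← zpow_neg]
      refine zpow_le_zpow_right₀ (by norm_num) ?_
      have := (hc u).1
      have := hm u
      omega
    rw [weight, if_pos h0]
    calc ((3 : ℝ) ^ L)⁻¹ = ((2 : ℝ) ^ L)⁻¹ * ((3 / 2 : ℝ) ^ L)⁻¹ := by
          rw [← mul_inv, ← mul_pow]; norm_num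
      _ ≤ nbrRate G lmax c u * (3 / 2) ^ c u := by
          gcongr
          exact nbrRate_nonneg u
      _ ≤ _ := by
          have : 0 ≤ nbrRate G lmax c u * (3 / 2) ^ c u :=
            mul_nonneg (nbrRate_nonneg u) (by positivity)
          linarith
  · exact h3

theorem le_potential_of_not_settled (hL : LargeCaps G lmax) (hc : IsConfig lmax c) {L : ℕ}
    (hm : ∀ v, lmax v ≤ L) {v : V} (hv : ¬ Settled G lmax c v) {e : ℝ} (he0 : 0 < e)
    (he1 : e < 1) : 1 / 100 * ((3 : ℝ) ^ L)⁻¹ ≤ potential G lmax e c v := by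
  have h3 : ((3 : ℝ) ^ L)⁻¹ ≤ 1 := inv_le_one_of_one_le₀ (one_le_pow₀ (by norm_num))
  have h3' : (0 : ℝ) < ((3 : ℝ) ^ L)⁻¹ := by positivity
  have hs : 1 / 100 ≤ spread G lmax c v := by
    have hz : (1 : ℝ) ≤ (6 / 5 : ℝ) ^ max (c v) 1 := one_le_zpow₀ (by norm_num) (by omega)
    have hw := nbrWeight_nonneg (G := G) (lmax := lmax) (c := c) v
    rw [spread]
    nlinarith
  refine mul_le_mul ?_ ?_ h3'.le (Real.rpow_nonneg (spread_pos v).le _)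
  · refine le_trans ?_ (Real.rpow_le_rpow (by norm_num) hs he0.le)
    calc (1 / 100 : ℝ) = (1 / 100) ^ (1 : ℝ) := (Real.rpow_one _).symm
      _ ≤ _ := Real.rpow_le_rpow_of_exponent_ge (by norm_num) (by norm_num) he1.le
  · refine le_trans ?_ (Real.rpow_le_rpow h3'.le (le_attempt_of_not_settled hL hc hm hv)
      (by linarith))
    calc ((3 : ℝ) ^ L)⁻¹ = (((3 : ℝ) ^ L)⁻¹) ^ (1 : ℝ) := (Real.rpow_one _).symm
      _ ≤ _ := Real.rpow_le_rpow_of_exponent_ge h3' h3 (by linarith)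

theorem degree_le_card (u : V) : (G.degree u : ℝ) ≤ Fintype.card V := by
  exact_mod_cast (G.degree_lt_card_verts u).le

theorem weight_le (u : V) : weight G lmax c u ≤ 4 * Fintype.card V := by
  have hn : (1 : ℝ) ≤ Fintype.card V := by exact_mod_cast Fintype.card_pos_iff.2 ⟨u⟩
  unfold weight
  split_ifs with h
  · have hd : nbrRate G lmax c u ≤ G.degree u * 1 := by
      rw [← SimpleGraph.card_neighborFinset_eq_degree, ← nsmul_eq_mul]
      exact Finset.sum_le_card_nsmul _ _ _ fun x _ => rates_le_one x
    have h0 := nbrRate_nonneg (G := G) (lmax := lmax) (c := c) u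
    have hz : (3 / 2 : ℝ) ^ c u ≤ 1 := zpow_le_one_of_nonpos₀ (by norm_num) h
    have := degree_le_card (G := G) u
    calc _ ≤ 4 * nbrRate G lmax c u * 1 := mul_le_mul_of_nonneg_left hz (by linarith)
      _ ≤ _ := by linarith
  · have := rates_le_one (lmax := lmax) (c := c) u
    linarith

theorem potential_le (hL : LargeCaps G lmax) (hc : IsConfig lmax c) {L : ℕ}
    (hm : ∀ v, lmax v ≤ L) (v : V) {e : ℝ} (he0 : 0 < e) (he1 : e < 1) :
    potential G lmax e c v ≤ 5 * 2 ^ L * (Fintype.card V : ℝ) ^ 2 := by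
  have hn : (1 : ℝ) ≤ Fintype.card V := by exact_mod_cast Fintype.card_pos_iff.2 ⟨v⟩
  have hw : nbrWeight G lmax c v ≤ G.degree v * (4 * Fintype.card V) := by
    rw [← SimpleGraph.card_neighborFinset_eq_degree, ← nsmul_eq_mul]
    exact Finset.sum_le_card_nsmul _ _ _ fun x _ => weight_le x
  have hw2 : nbrWeight G lmax c v ≤ Fintype.card V * (4 * Fintype.card V) :=
    hw.trans (mul_le_mul_of_nonneg_right (degree_le_card v) (by positivity))
  have hz : (6 / 5 : ℝ) ^ max (c v) 1 ≤ 2 ^ L := by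
    calc _ ≤ (6 / 5 : ℝ) ^ (L : ℤ) := by
          refine zpow_le_zpow_right₀ (by norm_num) ?_
          have := (hc v).2
          have := hm v
          have := hL.pos v
          omega
      _ ≤ _ := by rw [zpow_natCast]; exact pow_le_pow_left₀ (by norm_num) (by norm_num) _
  have h0 := nbrWeight_nonneg (G := G) (lmax := lmax) (c := c) v
  have hs : spread G lmax c v ≤ 5 * 2 ^ L * (Fintype.card V : ℝ) ^ 2 := by
    calc _ ≤ (2 : ℝ) ^ L * (5 * (Fintype.card V : ℝ) ^ 2) :=
          mul_le_mul hz (by nlinarith) (by linarith) (by positivity)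
      _ = _ := by ring
  have h1 : 1 ≤ 5 * 2 ^ L * (Fintype.card V : ℝ) ^ 2 := by
    have h2 : (1 : ℝ) ≤ 2 ^ L := one_le_pow₀ (by norm_num)
    have h3 : (1 : ℝ) ≤ (Fintype.card V : ℝ) ^ 2 := one_le_pow₀ hn
    nlinarith
  have ha : attempt G lmax c v ^ (1 - e) ≤ 1 :=
    Real.rpow_le_one (attempt_nonneg v) (attempt_le_one v) (by linarith)
  calc _ ≤ spread G lmax c v ^ e * 1 :=
        mul_le_mul_of_nonneg_left ha (Real.rpow_nonneg (spread_pos v).le _)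
    _ = spread G lmax c v ^ e := mul_one _
    _ ≤ (5 * 2 ^ L * (Fintype.card V : ℝ) ^ 2) ^ e :=
        Real.rpow_le_rpow (spread_pos v).le hs he0.le
    _ ≤ (5 * 2 ^ L * (Fintype.card V : ℝ) ^ 2) ^ (1 : ℝ) :=
        Real.rpow_le_rpow_of_exponent_le h1 he1.le
    _ = _ := Real.rpow_one _

/-- Neighbors at their caps are silent, so `u` beeps alone and falls to its lowest level, while they
hear it and stay at their caps. This makes settled vertices stable one round later, and permanently.
-/
theorem mem_misSet_update (hb : Legal lmax c b)
    {u : V} (hu : c u ≤ 0) (hx : ∀ x, G.Adj u x → (lmax x : ℤ) ≤ c x) :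
    u ∈ misSet G lmax (update G lmax c b) := by
  have hbu := (hb u).1 hu
  have hh : ¬ Hears G b u := by
    rintro ⟨x, hux, hbx⟩
    simp [(hb x).2 (hx x hux)] at hbx
  refine ⟨update_of_lonely hh hbu, fun x hux => ?_⟩
  rw [update_of_hears ⟨u, hux.symm, hbu⟩]
  have := hx x hux
  omega

theorem settled_update (hb : Legal lmax c b)
    {v : V} (hv : Settled G lmax c v) : Settled G lmax (update G lmax c b) v := by
  obtain ⟨u, hu, h0, hx⟩ := hv
  obtain ⟨h1, h2⟩ := mem_misSet_update hb h0 hx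
  exact ⟨u, hu, by omega, fun x hux => (h2 x hux).ge⟩

theorem misSet_subset_misSet_update (hb : Legal lmax c b) :
    misSet G lmax c ⊆ misSet G lmax (update G lmax c b) :=
  fun v hv => mem_misSet_update hb (by have := hv.1; omega) fun x hx => (hv.2 x hx).ge

theorem stableSet_update_of_settled (hb : Legal lmax c b) (hs : ∀ v, Settled G lmax c v) :
    stableSet G lmax (update G lmax c b) = Set.univ := by
  refine Set.eq_univ_of_forall fun v => ?_
  obtain ⟨u, hu, h0, hx⟩ := hs v
  have h := mem_misSet_update hb h0 hx
  rcases Finset.mem_insert.1 hu with rfl | hu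
  · exact Or.inl h
  · exact Or.inr ⟨u, h, (by simpa using hu : G.Adj v u).symm⟩

theorem isIndepSet_misSet (hL : LargeCaps G lmax) : G.IsIndepSet (misSet G lmax c) := by
  intro u hu v hv _ huv
  have h1 := hu.2 v huv
  have h2 := hv.1
  have := hL.pos v
  omega

theorem maximal_isIndepSet_misSet (hL : LargeCaps G lmax)
    (hs : stableSet G lmax c = Set.univ) : Maximal G.IsIndepSet (misSet G lmax c) := by
  refine ⟨isIndepSet_misSet hL, fun S hS hle w hw => ?_⟩
  rcases (hs ▸ Set.mem_univ w : w ∈ stableSet G lmax c) with h | ⟨v, hv, hvw⟩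
  · exact h
  · exact absurd hvw (hS (hle hv) hw hvw.ne)

end Potential

/-! ### From one round to the Markov chain: supports, decay, Markov's inequality. -/

section Chain

variable {V : Type*} [Fintype V] [DecidableEq V] {G : SimpleGraph V} [DecidableRel G.Adj]
  {lmax : V → ℕ} {c : Config V}

theorem beepLaw_apply (b : V → Bool) :
    beepLaw lmax c b = ENNReal.ofReal (bernWeight (rates lmax c) b) := by
  rw [bernWeight, ENNReal.ofReal_prod_of_nonneg fun v _ => by
    split_ifs
    · exact rates_nonneg v
    · exact sub_nonneg.2 (rates_le_one v)]
  unfold beepLaw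
  refine Eq.trans (b := ∏ v, ((if b v = true then beepProb (lmax v) (c v)
    else 1 - beepProb (lmax v) (c v) : ℝ≥0) : ℝ≥0∞)) rfl ?_
  refine Finset.prod_congr rfl fun v _ => ?_
  split_ifs
  · rw [rates, rate, ENNReal.ofReal_coe_nnreal]
  · rw [rates, rate, ← NNReal.coe_one, ← NNReal.coe_sub (beepProb_le_one _ _),
      ENNReal.ofReal_coe_nnreal]

theorem exists_legal_of_mem_support_round (hL : LargeCaps G lmax) {c' : Config V}
    (h : c' ∈ (round G lmax c).support) : ∃ b, Legal lmax c b ∧ update G lmax c b = c' := by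
  rw [round, PMF.mem_support_map_iff] at h
  obtain ⟨b, hb, rfl⟩ := h
  refine ⟨b, legal_of_bernWeight_ne_zero hL.pos fun h0 => ?_, rfl⟩
  rw [PMF.mem_support_iff, beepLaw_apply, h0, ENNReal.ofReal_zero] at hb
  exact hb rfl

/-- The predicate may depend on the time, which the countdown in
`noProminentPair_of_mem_support_law` needs. -/
theorem support_law_induction (hL : LargeCaps G lmax) {P : ℕ → Config V → Prop} (h0 : P 0 c)
    (hs : ∀ t c', P t c' → ∀ b, Legal lmax c' b → P (t + 1) (update G lmax c' b)) (t : ℕ) :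
    ∀ c' ∈ (law G lmax c t).support, P t c' := by
  induction t with
  | zero =>
    intro c' h
    rw [law, PMF.mem_support_pure_iff] at h
    exact h ▸ h0
  | succ t ih =>
    intro c' h
    rw [law, PMF.mem_support_bind_iff] at h
    obtain ⟨c₁, h1, h2⟩ := h
    obtain ⟨b, hb, rfl⟩ := exists_legal_of_mem_support_round hL h2
    exact hs t c₁ (ih c₁ h1) b hb

theorem law_add (s t : ℕ) :
    law G lmax c (s + t) = (law G lmax c s).bind fun c' => law G lmax c' t := by
  induction t with
  | zero => exact (PMF.bind_pure _).symm
  | succ t ih => rw [← add_assoc, law, ih, PMF.bind_bind]; rfl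

theorem tsum_round_mul {f : Config V → ℝ} (hf : ∀ c', 0 ≤ f c') :
    ∑' c', round G lmax c c' * ENNReal.ofReal (f c')
      = ENNReal.ofReal (bernExp (rates lmax c) fun b => f (update G lmax c b)) := by
  have h1 : ∀ c', round G lmax c c' * ENNReal.ofReal (f c') =
      ∑' b, beepLaw lmax c b *
        (PMF.pure (update G lmax c b) c' * ENNReal.ofReal (f c')) := by
    intro c'
    rw [round, ← PMF.bind_pure_comp, PMF.bind_apply, ← ENNReal.tsum_mul_right]
    simp only [Function.comp_apply, mul_assoc]
  simp only [h1]
  rw [ENNReal.tsum_comm]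
  simp only [ENNReal.tsum_mul_left, PMF.pure_apply, ite_mul, one_mul, zero_mul, tsum_ite_eq]
  rw [tsum_fintype, bernExp, ENNReal.ofReal_sum_of_nonneg fun b _ =>
    mul_nonneg (bernWeight_nonneg rates_nonneg rates_le_one b) (hf _)]
  refine Finset.sum_congr rfl fun b _ => ?_
  rw [beepLaw_apply, ENNReal.ofReal_mul (bernWeight_nonneg rates_nonneg rates_le_one b)]

/-- A function that contracts in expectation in every round from a set of configurations that is
never left decays exponentially in expectation. -/
theorem tsum_law_mul_le (hL : LargeCaps G lmax) {P : Config V → Prop} (h0 : P c)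
    (hs : ∀ c', P c' → ∀ b, Legal lmax c' b → P (update G lmax c' b)) {f : Config V → ℝ}
    (hf : ∀ c', 0 ≤ f c') {k : ℝ} (hk : 0 ≤ k)
    (h : ∀ c', P c' → bernExp (rates lmax c') (fun b => f (update G lmax c' b)) ≤ k * f c')
    (t : ℕ) :
    ∑' c', law G lmax c t c' * ENNReal.ofReal (f c') ≤ ENNReal.ofReal (k ^ t * f c) := by
  induction t with
  | zero => simp [law, PMF.pure_apply, ite_mul]
  | succ t ih =>
    have h1 : ∀ c', law G lmax c (t + 1) c' * ENNReal.ofReal (f c') =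
        ∑' c₁, law G lmax c t c₁ * (round G lmax c₁ c' * ENNReal.ofReal (f c')) := by
      intro c'
      rw [law, PMF.bind_apply, ← ENNReal.tsum_mul_right]
      simp only [mul_assoc]
    simp only [h1]
    rw [ENNReal.tsum_comm]
    simp only [ENNReal.tsum_mul_left, tsum_round_mul hf]
    calc _ ≤ ∑' c₁, ENNReal.ofReal k * (law G lmax c t c₁ * ENNReal.ofReal (f c₁)) := by
          refine ENNReal.tsum_le_tsum fun c₁ => ?_
          by_cases hc : c₁ ∈ (law G lmax c t).support
          · have hP := support_law_induction hL (P := fun _ => P) h0 (fun _ => hs) t c₁ hc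
            rw [mul_left_comm, ← ENNReal.ofReal_mul hk]
            exact mul_le_mul_right (ENNReal.ofReal_le_ofReal (h c₁ hP)) _
          · rw [PMF.mem_support_iff, not_not] at hc
            simp [hc]
      _ ≤ ENNReal.ofReal k * ENNReal.ofReal (k ^ t * f c) := by
          rw [ENNReal.tsum_mul_left]
          exact mul_le_mul_right ih _
      _ = _ := by rw [← ENNReal.ofReal_mul hk, pow_succ]; ring_nf

/-- Markov's inequality on the support of a probability mass function. -/
theorem mul_toOuterMeasure_le {α : Type*} (q : PMF α) {s : Set α} {f : α → ℝ≥0∞} {m : ℝ≥0∞}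
    (h : ∀ x ∈ q.support, x ∈ s → m ≤ f x) : m * q.toOuterMeasure s ≤ ∑' x, q x * f x := by
  rw [PMF.toOuterMeasure_apply, ← ENNReal.tsum_mul_left]
  refine ENNReal.tsum_le_tsum fun x => ?_
  by_cases hx : x ∈ s
  · rw [Set.indicator_of_mem hx, mul_comm]
    by_cases hq : x ∈ q.support
    · exact mul_le_mul_right (h x hq hx) _
    · rw [PMF.mem_support_iff, not_not] at hq
      simp [hq]
  · simp [Set.indicator_of_notMem hx]

theorem toOuterMeasure_bind_le {α β : Type*} (q : PMF α) (g : α → PMF β) {s : Set α} {s' : Set β}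
    {d : ℝ≥0∞} (h : ∀ x ∈ q.support, x ∉ s → (g x).toOuterMeasure s' ≤ d) :
    (q.bind g).toOuterMeasure s' ≤ q.toOuterMeasure s + d := by
  have hone : ∀ x, (g x).toOuterMeasure s' ≤ 1 := fun x => by
    rw [← (PMF.toOuterMeasure_apply_eq_one_iff (g x) _).2 (Set.subset_univ _)]
    exact MeasureTheory.measure_mono (Set.subset_univ _)
  rw [PMF.toOuterMeasure_bind_apply, PMF.toOuterMeasure_apply]
  calc _ ≤ ∑' x, (s.indicator q x + q x * d) := by
        refine ENNReal.tsum_le_tsum fun x => ?_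
        by_cases hx : x ∈ s
        · rw [Set.indicator_of_mem hx]
          exact le_add_right (mul_le_of_le_one_right' (hone x))
        · by_cases hq : x ∈ q.support
          · exact le_add_left (mul_le_mul_right (h x hq hx) _)
          · rw [PMF.mem_support_iff, not_not] at hq
            simp [hq]
    _ = _ := by rw [ENNReal.tsum_add, ENNReal.tsum_mul_right, PMF.tsum_coe, one_mul]

theorem one_sub_le_toReal_toOuterMeasure {α : Type*} (q : PMF α) {s : Set α} {d : ℝ} (hd : 0 ≤ d)
    (h : q.toOuterMeasure sᶜ ≤ ENNReal.ofReal d) : 1 - d ≤ (q.toOuterMeasure s).toReal := by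
  have h1 : (1 : ℝ≥0∞) ≤ q.toOuterMeasure s + q.toOuterMeasure sᶜ := by
    rw [← (PMF.toOuterMeasure_apply_eq_one_iff q _).2 (Set.subset_univ _), ← Set.union_compl_self s]
    exact MeasureTheory.measure_union_le _ _
  have h2 : q.toOuterMeasure s ≠ ∞ := by
    rw [PMF.toOuterMeasure_apply]
    exact q.tsum_coe_indicator_ne_top s
  have h3 : (1 : ℝ≥0∞) ≤ ENNReal.ofReal ((q.toOuterMeasure s).toReal + d) := by
    rw [ENNReal.ofReal_add ENNReal.toReal_nonneg hd, ENNReal.ofReal_toReal h2]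
    exact h1.trans (add_le_add_right h _)
  rw [ENNReal.one_le_ofReal] at h3
  linarith

/-- Adjacent nonpositive vertices cannot arise anew and both rise in every round, so after `t`
rounds each is at least `t` above its lowest level. This is impossible for `t` beyond the cap. -/
theorem noProminentPair_of_mem_support_law (hL : LargeCaps G lmax) (hc : IsConfig lmax c) {t : ℕ}
    (ht : ∀ v, lmax v < t) {c' : Config V} (h : c' ∈ (law G lmax c t).support) :
    IsConfig lmax c' ∧ NoProminentPair G c' := by
  have key := support_law_induction hL (c := c)
    (P := fun t c' => IsConfig lmax c' ∧ ∀ u x, G.Adj u x → c' u ≤ 0 → c' x ≤ 0 →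
      -(lmax u : ℤ) + t ≤ c' u)
    ⟨hc, fun u x _ _ _ => by have := (hc u).1; omega⟩ (by
      rintro t c' ⟨h1, h2⟩ b hb
      refine ⟨isConfig_update hL.pos h1, fun u x hux hu hx => ?_⟩
      have rise : ∀ u x, G.Adj u x → update G lmax c' b u ≤ 0 → update G lmax c' b x ≤ 0 →
          Hears G b u := by
        intro u x hux hu hx
        by_contra h
        have h3 := one_le_of_not_hears hb h hux
        have h5 := hL.one_lt x
        by_cases hbu : b u = true
        · rw [update_of_hears ⟨u, hux.symm, hbu⟩] at hx
          omega
        · rw [update_of_silent h hbu] at hu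
          omega
      have e1 := update_of_hears (lmax := lmax) (c := c') (rise u x hux hu hx)
      have e2 := update_of_hears (lmax := lmax) (c := c') (rise x u hux.symm hx hu)
      have m1 := hL.pos u
      have m2 := hL.pos x
      have := h2 u x hux (by omega) (by omega)
      push_cast
      omega) t c' h
  refine ⟨key.1, fun u x hux hu => ?_⟩
  by_contra hx
  have := key.2 u x hux hu (by omega)
  have := ht u
  omega

/-- The set only grows and always remains independent, so a maximal one is frozen. -/
theorem stabilizedToMIS_of_stableSet_eq_univ (hL : LargeCaps G lmax)
    (hs : stableSet G lmax c = Set.univ) : StabilizedToMIS G lmax c := by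
  refine ⟨hs, maximal_isIndepSet_misSet hL hs, fun t c' hc' => ?_⟩
  have hsub : misSet G lmax c ⊆ misSet G lmax c' :=
    support_law_induction hL (P := fun _ c' => misSet G lmax c ⊆ misSet G lmax c') subset_rfl
      (fun _ c₁ h b hb => h.trans (misSet_subset_misSet_update hb)) t c' hc'
  exact ((maximal_isIndepSet_misSet hL hs).2 (isIndepSet_misSet hL) hsub).antisymm hsub

end Chain

/-! ### Phases of growing degree and the union bound. -/

section Phases

variable {V : Type*} [Fintype V] [DecidableEq V] {G : SimpleGraph V} [DecidableRel G.Adj]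
  {lmax : V → ℕ} {c : Config V}

/-- If all vertices of degree less than `s` are settled, then the caps of the other neighbors of a
vertex of degree less than `2 * s ^ 2` are large. -/
theorem sum_capRate_le (hL : LargeCaps G lmax) {s t : ℕ} (hst : t ≤ 2 * max 1 s ^ 2)
    (hs : ∀ v, G.degree v < s → Settled G lmax c v) {v : V} (hv : G.degree v < t) :
    ∑ u ∈ G.neighborFinset v, capRate G lmax c u ≤ 1 / 100000 := by
  have hM : (1 : ℝ) ≤ (max 1 s : ℕ) := by exact_mod_cast le_max_left 1 s
  have hb : ∀ u ∈ G.neighborFinset v, capRate G lmax c u ≤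
      (((max 1 s : ℕ) : ℝ) ^ 2 * 2 ^ 30)⁻¹ := by
    intro u hu
    unfold capRate
    split_ifs with h
    · positivity
    · have h1 : s ≤ G.degree u := by
        by_contra h1
        exact h (hs u (not_le.1 h1))
      -- A neighbor of `v` has positive degree; this lets the first phase start from `s = 0` and
      -- explains `max 1 s`.
      have h2 : 1 ≤ G.degree u :=
        (G.degree_pos_iff_exists_adj u).2 ⟨v, (by simpa using hu : G.Adj v u).symm⟩
      have h3 : ((max 1 s : ℕ) : ℝ) ≤ G.degree u := by exact_mod_cast max_le h2 h1
      rw [zpow_neg, zpow_natCast]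
      refine inv_anti₀ (by positivity) (le_trans ?_ (hL u).2)
      gcongr
  have hd : (G.degree v : ℝ) ≤ 2 * ((max 1 s : ℕ) : ℝ) ^ 2 := by
    exact_mod_cast (hv.trans_le hst).le
  calc _ ≤ (G.degree v : ℝ) * (((max 1 s : ℕ) : ℝ) ^ 2 * 2 ^ 30)⁻¹ := by
        rw [← SimpleGraph.card_neighborFinset_eq_degree, ← nsmul_eq_mul]
        exact Finset.sum_le_card_nsmul _ _ _ hb
    _ ≤ 2 * ((max 1 s : ℕ) : ℝ) ^ 2 * (((max 1 s : ℕ) : ℝ) ^ 2 * 2 ^ 30)⁻¹ := by gcongr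
    _ = 2 / 2 ^ 30 := by field_simp
    _ ≤ _ := by norm_num

/-- In one phase all vertices of degree less than `2 * s ^ 2` become settled. -/
theorem toOuterMeasure_not_settled_le (hL : LargeCaps G lmax) (hc : IsConfig lmax c)
    (hI : NoProminentPair G c) {L : ℕ} (hm : ∀ v, lmax v ≤ L) {e k : ℝ}
    (he0 : 0 < e) (he1 : e < 1) (hk : 0 ≤ k) (h1 : (4 : ℝ) ^ e * (1 - 1 / 10 ^ 8) ^ (1 - e) ≤ k)
    (h2 : (19 / 20 : ℝ) ^ e * 1 ^ (1 - e) ≤ k) {s t : ℕ} (hst : t ≤ 2 * max 1 s ^ 2)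
    (hs : ∀ v, G.degree v < s → Settled G lmax c v) (τ : ℕ) :
    (law G lmax c τ).toOuterMeasure {c' | ¬ ∀ v, G.degree v < t → Settled G lmax c' v} ≤
      ENNReal.ofReal (500 * k ^ τ * 6 ^ L * (Fintype.card V : ℝ) ^ 3) := by
  let P : Config V → Prop := fun c' => IsConfig lmax c' ∧ NoProminentPair G c' ∧
    ∀ v, G.degree v < s → Settled G lmax c' v
  have hP0 : P c := ⟨hc, hI, hs⟩
  have hP : ∀ c', P c' → ∀ b, Legal lmax c' b → P (update G lmax c' b) := fun c' h b hb =>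
    ⟨isConfig_update hL.pos h.1, noProminentPair_update hL.one_lt h.2.1 hb,
      fun v hv => settled_update hb (h.2.2 v hv)⟩
  have hone : ∀ v, G.degree v < t →
      (law G lmax c τ).toOuterMeasure {c' | ¬ Settled G lmax c' v} ≤
        ENNReal.ofReal (500 * k ^ τ * 6 ^ L * (Fintype.card V : ℝ) ^ 2) := by
    intro v hv
    have hd := tsum_law_mul_le hL hP0 hP (f := fun c' => potential G lmax e c' v)
      (fun c' => potential_nonneg e v) hk (fun c' h => bernExp_potential_le hL h.1 h.2.1
        (sum_capRate_le hL hst h.2.2 hv) he0 he1 h1 h2) τ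
    have hmk := (mul_toOuterMeasure_le (law G lmax c τ) (s := {c' | ¬ Settled G lmax c' v})
      (f := fun c' => ENNReal.ofReal (potential G lmax e c' v))
      (m := ENNReal.ofReal (1 / 100 * ((3 : ℝ) ^ L)⁻¹)) fun c' hc' hv' =>
        ENNReal.ofReal_le_ofReal (le_potential_of_not_settled hL
          (support_law_induction hL (P := fun _ => P) hP0 (fun _ => hP) τ c' hc').1 hm hv'
          he0 he1)).trans hd
    have hm0 : (0 : ℝ) < 1 / 100 * ((3 : ℝ) ^ L)⁻¹ := by positivity
    rw [mul_comm, ← ENNReal.le_div_iff_mul_le (Or.inl (ENNReal.ofReal_pos.2 hm0).ne')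
      (Or.inl ENNReal.ofReal_ne_top), ← ENNReal.ofReal_div_of_pos hm0] at hmk
    refine hmk.trans (ENNReal.ofReal_le_ofReal ?_)
    rw [div_le_iff₀ hm0]
    -- The upper bound `5 * 2^L * n^2` divided by the lower bound `3^(-L) / 100` gives `500 * 6^L *
    -- n^2`.
    calc k ^ τ * potential G lmax e c v
        ≤ k ^ τ * (5 * 2 ^ L * (Fintype.card V : ℝ) ^ 2) := by
          gcongr
          exact potential_le hL hc hm v he0 he1
      _ = _ := by
          have : (6 : ℝ) ^ L = 2 ^ L * 3 ^ L := by rw [← mul_pow]; norm_num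
          rw [this]
          field_simp
          ring
  have hsub : {c' | ¬ ∀ v, G.degree v < t → Settled G lmax c' v} ⊆
      ⋃ v ∈ (Finset.univ.filter fun v => G.degree v < t : Finset V),
        {c' | ¬ Settled G lmax c' v} := by
    intro c' h
    simp only [Set.mem_ofPred_eq, not_forall] at h
    obtain ⟨v, hv, hn⟩ := h
    simp only [Set.mem_iUnion]
    exact ⟨v, by simpa using hv, hn⟩
  calc _ ≤ _ := MeasureTheory.measure_mono hsub
    _ ≤ ∑ v ∈ Finset.univ.filter fun v => G.degree v < t,
        (law G lmax c τ).toOuterMeasure {c' | ¬ Settled G lmax c' v} :=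
      MeasureTheory.measure_biUnion_finset_le _ _
    _ ≤ (Finset.univ.filter fun v => G.degree v < t).card •
        ENNReal.ofReal (500 * k ^ τ * 6 ^ L * (Fintype.card V : ℝ) ^ 2) :=
      Finset.sum_le_card_nsmul _ _ _ fun v hv => hone v (Finset.mem_filter.1 hv).2
    _ ≤ Fintype.card V • ENNReal.ofReal (500 * k ^ τ * 6 ^ L * (Fintype.card V : ℝ) ^ 2) :=
      nsmul_le_nsmul_left zero_le (Finset.card_le_univ _)
    _ = _ := by
      rw [← ENNReal.ofReal_nsmul, nsmul_eq_mul]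
      ring_nf

/-- The degree thresholds of the phases. -/
def phaseBound : ℕ → ℕ
  | 0 => 0
  | k + 1 => 2 ^ 2 ^ k

/-- The factor 2 serves only the first step, from 0 to 2; later thresholds are exact squares. -/
theorem phaseBound_succ_le (i : ℕ) : phaseBound (i + 1) ≤ 2 * max 1 (phaseBound i) ^ 2 := by
  cases i with
  | zero => simp [phaseBound]
  | succ i =>
    have h : phaseBound (i + 2) = phaseBound (i + 1) ^ 2 := by
      simp only [phaseBound]
      rw [← pow_mul, pow_succ]
    rw [h]
    calc _ ≤ max 1 (phaseBound (i + 1)) ^ 2 := Nat.pow_le_pow_left (le_max_right _ _) 2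
      _ ≤ _ := by omega

theorem toOuterMeasure_phases_le (hL : LargeCaps G lmax) (hc : IsConfig lmax c)
    (hI : NoProminentPair G c) {τ : ℕ} {d : ℝ≥0∞}
    (hd : ∀ c', IsConfig lmax c' → NoProminentPair G c' → ∀ i,
      (∀ v, G.degree v < phaseBound i → Settled G lmax c' v) →
      (law G lmax c' τ).toOuterMeasure
        {c₁ | ¬ ∀ v, G.degree v < phaseBound (i + 1) → Settled G lmax c₁ v} ≤ d) (i : ℕ) :
    (law G lmax c (i * τ)).toOuterMeasure
      {c' | ¬ ∀ v, G.degree v < phaseBound i → Settled G lmax c' v} ≤ i * d := by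
  induction i with
  | zero => simp [phaseBound]
  | succ i ih =>
    rw [Nat.succ_mul, law_add]
    refine (toOuterMeasure_bind_le _ _ fun c' hc' hs => ?_).trans
      ((add_le_add_left ih d).trans_eq ?_)
    · obtain ⟨h1, h2⟩ := support_law_induction hL
        (P := fun _ c' => IsConfig lmax c' ∧ NoProminentPair G c') ⟨hc, hI⟩
        (fun _ c₁ h b hb => ⟨isConfig_update hL.pos h.1, noProminentPair_update hL.one_lt h.2 hb⟩)
        _ c' hc'
      exact hd c' h1 h2 i (not_not.1 hs)
    · push_cast
      ring

/-- The budget is `L + 1` rounds to remove prominent pairs, `K` phases of `τ` rounds, and one round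
that turns settled vertices into stable ones. -/
theorem toOuterMeasure_not_stabilized_le (hL : LargeCaps G lmax) (hc : IsConfig lmax c)
    {L : ℕ} (hm : ∀ v, lmax v ≤ L) {e k : ℝ} (he0 : 0 < e) (he1 : e < 1) (hk : 0 ≤ k)
    (h1 : (4 : ℝ) ^ e * (1 - 1 / 10 ^ 8) ^ (1 - e) ≤ k)
    (h2 : (19 / 20 : ℝ) ^ e * 1 ^ (1 - e) ≤ k) {K τ T : ℕ}
    (hK : Fintype.card V ≤ phaseBound K) (hT : L + 1 + K * τ + 1 ≤ T) :
    (law G lmax c T).toOuterMeasure {c' | StabilizedToMIS G lmax c'}ᶜ ≤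
      ENNReal.ofReal (K * (500 * k ^ τ * 6 ^ L * (Fintype.card V : ℝ) ^ 3)) := by
  have hphase : (law G lmax c (L + 1 + K * τ)).toOuterMeasure
      {c' | ¬ ∀ v, Settled G lmax c' v} ≤
      ENNReal.ofReal (K * (500 * k ^ τ * 6 ^ L * (Fintype.card V : ℝ) ^ 3)) := by
    rw [law_add]
    -- The bad set is empty because the absence of prominent pairs is certain, not just likely.
    refine (toOuterMeasure_bind_le _ _ (s := ∅) fun c' hc' _ => ?_).trans_eq
      (by rw [MeasureTheory.measure_empty, zero_add])
    obtain ⟨h3, h4⟩ := noProminentPair_of_mem_support_law hL hc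
      (fun v => Nat.lt_succ_of_le (hm v)) hc'
    have h5 := toOuterMeasure_phases_le hL h3 h4 (τ := τ)
      (fun c₁ h5 h6 i hs => toOuterMeasure_not_settled_le hL h5 h6 hm he0 he1 hk h1 h2
        (phaseBound_succ_le i) hs τ) K
    rw [ENNReal.ofReal_mul (Nat.cast_nonneg K), ENNReal.ofReal_natCast]
    refine le_trans (MeasureTheory.measure_mono fun c₁ h => ?_) h5
    exact fun h' => h fun v => h' v ((G.degree_lt_card_verts v).trans_le hK)
  obtain ⟨r, rfl⟩ : ∃ r, T = L + 1 + K * τ + (r + 1) := ⟨T - (L + 1 + K * τ + 1), by omega⟩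
  rw [law_add]
  refine ((toOuterMeasure_bind_le _ _ (d := 0) fun c' _ hs => ?_).trans_eq (add_zero _)).trans
    hphase
  rw [nonpos_iff_eq_zero, PMF.toOuterMeasure_apply_eq_zero_iff, Set.disjoint_compl_right_iff_subset]
  intro c₁ hc₁
  rw [law, PMF.mem_support_bind_iff] at hc₁
  obtain ⟨c₂, h3, h4⟩ := hc₁
  obtain ⟨b, hb, rfl⟩ := exists_legal_of_mem_support_round hL h4
  refine stabilizedToMIS_of_stableSet_eq_univ hL (stableSet_update_of_settled hb ?_)
  exact support_law_induction hL (P := fun _ c₂ => ∀ v, Settled G lmax c₂ v) (not_not.1 hs)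
    (fun _ c₂ h b hb v => settled_update hb (h v)) r c₂ h3

end Phases

/-! ### Logarithms and the choice of constants. -/

theorem largeCaps_of_logb {V : Type*} [Fintype V] {G : SimpleGraph V} [DecidableRel G.Adj]
    {lmax : V → ℕ} {c₁ : ℝ} (hc₁ : 30 ≤ c₁)
    (h : ∀ v, 2 * Real.logb 2 (G.degree v) + c₁ ≤ lmax v) : LargeCaps G lmax := by
  intro v
  have hv := h v
  have h0 : 0 ≤ Real.logb 2 (G.degree v) := by
    rcases Nat.eq_zero_or_pos (G.degree v) with h | h
    · simp [h]
    · exact Real.logb_nonneg (by norm_num) (by exact_mod_cast h)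
  refine ⟨by exact_mod_cast (by linarith : (30 : ℝ) ≤ lmax v), ?_⟩
  rcases Nat.eq_zero_or_pos (G.degree v) with hd | hd
  · rw [hd]
    norm_num
  · have hd' : (0 : ℝ) < G.degree v := by exact_mod_cast hd
    have h2 : (G.degree v : ℝ) = 2 ^ Real.logb 2 (G.degree v) :=
      (Real.rpow_logb (by norm_num) (by norm_num) hd').symm
    calc (G.degree v : ℝ) ^ 2 * 2 ^ 30 =
        (2 : ℝ) ^ (Real.logb 2 (G.degree v) * (2 : ℕ) + (30 : ℕ)) := by
          rw [Real.rpow_add (by norm_num), Real.rpow_mul_natCast (by norm_num), ← h2,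
            Real.rpow_natCast]
      _ ≤ (2 : ℝ) ^ (lmax v : ℝ) :=
          Real.rpow_le_rpow_of_exponent_le (by norm_num) (by push_cast; linarith)
      _ = _ := Real.rpow_natCast _ _

theorem three_halves_le_logb {n : ℕ} (hn : 3 ≤ n) : 3 / 2 ≤ Real.logb 2 n := by
  have hn' : (3 : ℝ) ≤ n := by exact_mod_cast hn
  rw [Real.le_logb_iff_rpow_le (by norm_num) (by linarith)]
  refine le_trans (le_of_sq_le_sq ?_ (by norm_num)) hn'
  rw [← Real.rpow_mul_natCast (by norm_num)]
  norm_num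

theorem half_le_logb {x : ℝ} (hx : 3 / 2 ≤ x) : 1 / 2 ≤ Real.logb 2 x := by
  rw [Real.le_logb_iff_rpow_le (by norm_num) (by linarith)]
  refine le_trans (le_of_sq_le_sq ?_ (by norm_num)) hx
  rw [← Real.rpow_mul_natCast (by norm_num)]
  norm_num

/-- The number of phases is at most `log₂ log₂ n + 2`. -/
theorem exists_phaseBound_ge {n : ℕ} (hn : 3 ≤ n) :
    ∃ K : ℕ, n ≤ phaseBound K ∧ (K : ℝ) ≤ Real.logb 2 (Real.logb 2 n) + 2 := by
  have hn' : (0 : ℝ) < n := by exact_mod_cast (by omega : 0 < n)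
  have hl := three_halves_le_logb hn
  have hll := half_le_logb hl
  refine ⟨⌈Real.logb 2 (Real.logb 2 n)⌉₊ + 1, ?_, ?_⟩
  · have h1 : Real.logb 2 n ≤ (2 ^ ⌈Real.logb 2 (Real.logb 2 n)⌉₊ : ℕ) := by
      calc Real.logb 2 n = 2 ^ Real.logb 2 (Real.logb 2 n) :=
            (Real.rpow_logb (by norm_num) (by norm_num) (by linarith)).symm
        _ ≤ 2 ^ (⌈Real.logb 2 (Real.logb 2 n)⌉₊ : ℝ) :=
            Real.rpow_le_rpow_of_exponent_le (by norm_num) (Nat.le_ceil _)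
        _ = _ := by rw [Real.rpow_natCast]; norm_cast
    have h2 : (n : ℝ) ≤ (2 ^ 2 ^ ⌈Real.logb 2 (Real.logb 2 n)⌉₊ : ℕ) := by
      calc (n : ℝ) = 2 ^ Real.logb 2 n := (Real.rpow_logb (by norm_num) (by norm_num) hn').symm
        _ ≤ 2 ^ ((2 ^ ⌈Real.logb 2 (Real.logb 2 n)⌉₊ : ℕ) : ℝ) :=
            Real.rpow_le_rpow_of_exponent_le (by norm_num) h1
        _ = _ := by rw [Real.rpow_natCast]; norm_cast
    exact_mod_cast h2
  · push_cast
    linarith [Nat.ceil_lt_add_one (by linarith : 0 ≤ Real.logb 2 (Real.logb 2 n))]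

/-- The failure probability after sufficiently long phases. -/
theorem failure_le {n K L τ : ℕ} {k c₂ a : ℝ} (hn : 3 ≤ n) (hk0 : 0 < k)
    (hK : (K : ℝ) ≤ Real.logb 2 (Real.logb 2 n) + 2) (hL : (L : ℝ) ≤ c₂ * Real.logb 2 n)
    (hτ : (15 + 3 * c₂ + a) * Real.logb 2 n ≤ τ * -Real.logb 2 k) :
    K * (500 * k ^ τ * 6 ^ L * (n : ℝ) ^ 3) ≤ (n : ℝ) ^ (-a) := by
  have hn' : (3 : ℝ) ≤ n := by exact_mod_cast hn
  have hl := three_halves_le_logb hn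
  set l := Real.logb 2 n with hldef
  have hnl : (n : ℝ) = 2 ^ l := (Real.rpow_logb (by norm_num) (by norm_num) (by linarith)).symm
  have two : (1 : ℝ) ≤ 2 := by norm_num
  -- The tangent bound for `2^x` itself has slope `log 2 < 1` and is too weak, so `2^(x/2)` is
  -- bounded and squared.
  have hlog : ∀ x : ℝ, 0 < x → Real.logb 2 x ≤ x := by
    intro x hx
    rw [Real.logb_le_iff_le_rpow (by norm_num) hx]
    have h2 := Real.log_two_gt_d9
    have h3 := Real.add_one_le_exp (x / 2 * Real.log 2)
    rw [Real.rpow_def_of_pos (by norm_num)]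
    have h4 : Real.exp (Real.log 2 * x) = Real.exp (x / 2 * Real.log 2) ^ 2 := by
      rw [← Real.exp_nat_mul]; ring_nf
    have h5 : 1 + 17 / 50 * x ≤ Real.exp (x / 2 * Real.log 2) := by nlinarith
    rw [h4]
    refine le_trans ?_ (pow_le_pow_left₀ (by positivity) h5 2)
    nlinarith [sq_nonneg (x - 2)]
  have b1 : (K : ℝ) ≤ 2 ^ (3 * l) := by
    have h1 := hlog l (by linarith)
    have h2 := hlog n (by linarith)
    calc (K : ℝ) ≤ n + 2 := by linarith
      _ ≤ (n : ℝ) ^ 3 := by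
        nlinarith [mul_nonneg (by linarith : (0 : ℝ) ≤ n) (sq_nonneg ((n : ℝ) - 1))]
      _ = 2 ^ (3 * l) := by
        rw [hnl, ← Real.rpow_mul_natCast (by norm_num), mul_comm]; norm_num
  have b2 : (500 : ℝ) ≤ 2 ^ (9 * l) := by
    calc (500 : ℝ) ≤ 2 ^ (9 : ℝ) := by norm_num
      _ ≤ _ := Real.rpow_le_rpow_of_exponent_le two (by linarith)
  have b3 : k ^ τ ≤ (2 : ℝ) ^ (-((15 + 3 * c₂ + a) * l)) := by
    calc k ^ τ = ((2 : ℝ) ^ Real.logb 2 k) ^ τ := by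
          rw [Real.rpow_logb (by norm_num) (by norm_num) hk0]
      _ = 2 ^ (Real.logb 2 k * τ) := (Real.rpow_mul_natCast (by norm_num) _ _).symm
      _ ≤ _ := Real.rpow_le_rpow_of_exponent_le two (by linarith)
  have b4 : (6 : ℝ) ^ L ≤ 2 ^ (3 * c₂ * l) := by
    calc (6 : ℝ) ^ L ≤ (2 ^ (3 : ℝ)) ^ L := pow_le_pow_left₀ (by norm_num) (by norm_num) _
      _ = 2 ^ ((3 : ℝ) * L) := (Real.rpow_mul_natCast (by norm_num) _ _).symm
      _ ≤ _ := Real.rpow_le_rpow_of_exponent_le two (by linarith)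
  have b5 : (n : ℝ) ^ 3 = 2 ^ (3 * l) := by
    rw [hnl, ← Real.rpow_mul_natCast (by norm_num), mul_comm]; norm_num
  -- The exponents of `n` are 3 for `K`, 9 for 500, `3 * c₂` for `6^L` and 3 for `n^3`, which
  -- explains `15 + 3 * c₂ + a`.
  calc (K : ℝ) * (500 * k ^ τ * 6 ^ L * (n : ℝ) ^ 3)
      ≤ 2 ^ (3 * l) * (2 ^ (9 * l) * 2 ^ (-((15 + 3 * c₂ + a) * l)) * 2 ^ (3 * c₂ * l)
        * 2 ^ (3 * l)) := by
        rw [b5]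
        gcongr
    _ = (2 : ℝ) ^ (l * -a) := by
        simp only [← Real.rpow_add (zero_lt_two (α := ℝ))]
        ring_nf
    _ = (n : ℝ) ^ (-a) := by rw [Real.rpow_mul (by norm_num), ← hnl]

end BeepingMIS

/-- The logarithms are to base 2; an isolated vertex has `Real.logb 2 0 = 0`, that is, its cap is at
least `c₁`. The constant `C` depends only on `c₁`, `c₂` and the exponent `a` of the failure
probability `n ^ (-a)`, where `n = Fintype.card V`. -/
theorem theorem2 (c₁ c₂ a : ℝ) (hc₁ : 30 ≤ c₁) (hc₂ : 0 < c₂) (ha : 0 < a) :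
    ∃ C : ℝ, 0 < C ∧
      ∀ (V : Type*) [Fintype V] (G : SimpleGraph V) [DecidableRel G.Adj] (lmax : V → ℕ)
        (c : BeepingMIS.Config V) (T : ℕ),
        3 ≤ Fintype.card V →
        (∀ v, 2 * Real.logb 2 (G.degree v) + c₁ ≤ lmax v ∧
          lmax v ≤ c₂ * Real.logb 2 (Fintype.card V)) →
        BeepingMIS.IsConfig lmax c →
        C * (Real.logb 2 (Fintype.card V) * Real.logb 2 (Real.logb 2 (Fintype.card V))) ≤ T →
        1 - (Fintype.card V : ℝ) ^ (-a) ≤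
          ((BeepingMIS.law G lmax c T).toOuterMeasure
            {c' | BeepingMIS.StabilizedToMIS G lmax c'}).toReal := by
  classical
  open BeepingMIS in
  obtain ⟨e, k, he0, he1, hk0, hk1, h1, h2⟩ := exists_drift_constants
  have hlk : 0 < -Real.logb 2 k := neg_pos.2 (Real.logb_neg (by norm_num) hk0 hk1)
  set M : ℝ := (15 + 3 * c₂ + a) / -Real.logb 2 k with hM
  have hM0 : 0 < M := by positivity
  -- With `l = log₂ n ≥ 3/2` and `ll = log₂ l ≥ 1/2`: `L ≤ 2 * c₂ * l * ll`, `K ≤ ll + 2 ≤ 5 * ll`,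
  -- `τ ≤ (M + 1) * l`, and the two extra rounds are at most `4 * l * ll`.
  refine ⟨2 * c₂ + 5 * (M + 1) + 4, by positivity, ?_⟩
  intro V _ G _ lmax c T hn hcap hc hT
  have hl := three_halves_le_logb hn
  have hll := half_le_logb hl
  obtain ⟨K, hK1, hK2⟩ := exists_phaseBound_ge hn
  set l := Real.logb 2 (Fintype.card V)
  set ll := Real.logb 2 l
  have hL : LargeCaps G lmax := largeCaps_of_logb hc₁ fun v => (hcap v).1
  have hLle : (⌊c₂ * l⌋₊ : ℝ) ≤ c₂ * l := Nat.floor_le (by positivity)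
  have hm : ∀ v, lmax v ≤ ⌊c₂ * l⌋₊ := fun v => Nat.le_floor (hcap v).2
  have hτ1 : M * l ≤ ⌈M * l⌉₊ := Nat.le_ceil _
  have hτ2 : (⌈M * l⌉₊ : ℝ) ≤ (M + 1) * l := by
    linarith [Nat.ceil_lt_add_one (by positivity : 0 ≤ M * l)]
  have hlll : l ≤ 2 * (l * ll) := by nlinarith
  have hTle : ⌊c₂ * l⌋₊ + 1 + K * ⌈M * l⌉₊ + 1 ≤ T := by
    have hK3 : (K : ℝ) * ⌈M * l⌉₊ ≤ 5 * ll * ((M + 1) * l) := by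
      gcongr
      linarith
    have h3 : c₂ * l ≤ c₂ * (2 * (l * ll)) := mul_le_mul_of_nonneg_left hlll hc₂.le
    have h4 : (⌊c₂ * l⌋₊ : ℝ) + 1 + K * ⌈M * l⌉₊ + 1 ≤ T := by
      refine le_trans ?_ hT
      linarith
    exact_mod_cast h4
  refine one_sub_le_toReal_toOuterMeasure _ (by positivity)
    ((toOuterMeasure_not_stabilized_le hL hc hm he0 he1 hk0.le h1 h2 hK1 hTle).trans
      (ENNReal.ofReal_le_ofReal (failure_le hn hk0 hK2 hLle ?_)))
  calc (15 + 3 * c₂ + a) * l = M * l * -Real.logb 2 k := by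
        rw [hM, div_mul_eq_mul_div, div_mul_cancel₀ _ hlk.ne']
    _ ≤ _ := mul_le_mul_of_nonneg_right hτ1 hlk.le
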